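/- Let $n\ge 2$, let $H^{(n)}=L^2(S^1,\mathbb C^n)$ with the subspace $H^{(n)}_+$ of functions without negative Fourier modes, and let $\mathcal W(z)$ be a loop in $L_{1/2}GL(n,\mathbb C)$ (measurable, essentially bounded with essentially bounded inverse, $\sum_k |k|\,\|\mathcal W^{(k)}\|^2<\infty$) whose Fourier series at $z=\infty$ is an upper unitriangular constant matrix plus $O(1/z)$. Let $W=\mathcal W(z)H^{(n)}_+$, and assume that $W$ is in the big cell, i.e. that the orthogonal projection $W\to H^{(n)}_+$ is bijective. Identify $H^{(n)}$ with $L^2(S^1)$ by $\Xi(f_0,\dots,f_{n-1})=\sum_i z^i f_i(z^n)$. Let $D=\partial/\partial t_1$ and $\xi(t,z)=\sum_{i\ge1}t_iz^i$. The dressing operator of $W$ is the pseudodifferential operator $S_W=1+\sum_{i\ge 1}s_i(t)D^{-i}$, with coefficients in $\mathbb C[[t_1,t_2,\dots]]$, whose wave function $\psi_W(t;z)=S_W e^{\xi(t,z)}=e^{\xi(t,z)}\bigl(1+\sum_{i\ge1} s_i(t)z^{-i}\bigr)$ takes values in $\Xi(W)$ (coefficient by coefficient in $t$), and $L_W=S_WD^nS_W^{-1}$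 is the Lax operator. Suppose that $W$ is in the Burchnall–Chaundy locus: $[L_W,M]=0$ for some differential operator $M$ in $D$ of order $m$ coprime to $n$. Then there are a differential operator $M_W$ of order $m$ with $[L_W,M_W]=0$ and a Laurent series $b(z)=z^m+\sum_{k<m}b_kz^k$ in $1/z$ with complex coefficients and with $b_{ns}=0$ for all $s\in\mathbb Z$, such that $S_W^{-1}M_WS_W=b(D)$. For every such pair $(M_W,b)$, let $B(z)=b(\Lambda)$, where $\Lambda$ is the $n\times n$ matrix with ones directly below the diagonal, $z$ in the upper right corner and zeros elsewhere, and put $$C(z)=\mathcal W(z)^{-1}B(z)\,\mathcal W(z)$$ (as matrices of Laurent series in $1/z$). Then: 1. $C(z)$ is polynomial in $z$. 2. $\operatorname{trace} C(z)=0$. 3. $\max_i\,(i-j+n\deg C_{ij}(z))=m$ for every column $j$, and $\max_j\,(i-j+n\deg C_{ij}(z))=m$ for every row $i$, where $C_{ij}$ is the entry in row $i$ and column $j$, and $\deg 0=-\infty$. 4. The characteristic polynomial $p_{C(z)}(\lambda)\in\mathbb C[z,\lambda]$ defines the spectral curve of the solution: it is irreducible, and a polynomial $F(z,\lambda)\in\mathbb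 C[z,\lambda]$ satisfies $F(L_W,M_W)=0$ if and only if $p_{C(z)}(\lambda)$ divides $F$. -/

import Mathlib

open MeasureTheory AddCircle

noncomputable section

namespace GelfandDickey

/-! ## Loops and subspaces of `H⁽ⁿ⁾ = L²(S¹, ℂⁿ)`

The unit circle is `UnitAddCircle`, with `z = fourier 1` and normalised Haar measure. -/

/-- The Hilbert space `H⁽ⁿ⁾ = L²(S¹, ℂⁿ)`. -/
abbrev Hn (n : ℕ) : Type :=
  Lp (EuclideanSpace ℂ (Fin n)) 2 (haarAddCircle : Measure UnitAddCircle)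

/-- Coefficient of `f ∈ H⁽ⁿ⁾` on the basis vector `e_{i,k}` (that is, `z ^ k` in the slot `i`). -/
def vecCoeff {n : ℕ} (f : Hn n) (i : Fin n) (k : ℤ) : ℂ :=
  fourierCoeff (fun t : UnitAddCircle => f t i) k

/-- `H₊⁽ⁿ⁾`: no negative Fourier modes. -/
def HPlus (n : ℕ) : Set (Hn n) :=
  {f | ∀ (i : Fin n) (k : ℤ), k < 0 → vecCoeff f i k = 0}

/-- A matrix-valued function on the circle. -/
abbrev MatLoop (n : ℕ) : Type := UnitAddCircle → Matrix (Fin n) (Fin n) ℂ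

/-- The `k`-th Fourier coefficient `γ⁽ᵏ⁾` of a loop, entry by entry. -/
def loopCoeff {n : ℕ} (γ : MatLoop n) (k : ℤ) : Matrix (Fin n) (Fin n) ℂ :=
  Matrix.of fun i j => fourierCoeff (fun t => γ t i j) k

/-- The loop group `L_{1/2} GL(n, ℂ)`: measurable, essentially bounded loops with essentially
bounded inverse and `∑ |k| ‖γ⁽ᵏ⁾‖² < ∞` (Hilbert-Schmidt norm). -/
structure IsHalfLoop {n : ℕ} (γ : MatLoop n) : Prop where
  meas : ∀ i j, AEStronglyMeasurable (fun t => γ t i j) haarAddCircle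
  bdd : ∃ K : ℝ, ∀ᵐ t ∂haarAddCircle, ∀ i j, ‖γ t i j‖ ≤ K
  inv : ∀ᵐ t ∂haarAddCircle, IsUnit (γ t).det
  inv_bdd : ∃ K : ℝ, ∀ᵐ t ∂haarAddCircle, ∀ i j, ‖(γ t)⁻¹ i j‖ ≤ K
  half : Summable fun k : ℤ => |(k : ℝ)| * ∑ i, ∑ j, ‖loopCoeff γ k i j‖ ^ 2

/-- The Fourier series of `γ` at `z = ∞` is an upper unitriangular matrix plus `O(1 / z)`. -/
structure IsNormalized {n : ℕ} (γ : MatLoop n) : Prop where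
  pos : ∀ k : ℤ, 0 < k → loopCoeff γ k = 0
  diag : ∀ i, loopCoeff γ 0 i i = 1
  lower : ∀ i j, j < i → loopCoeff γ 0 i j = 0

/-- The subspace `W = γ H₊⁽ⁿ⁾` of `H⁽ⁿ⁾`. -/
def loopSpace {n : ℕ} (γ : MatLoop n) : Set (Hn n) :=
  {g | ∃ f ∈ HPlus n, ∀ᵐ t ∂haarAddCircle,
    (fun i => g t i) = Matrix.mulVec (γ t) (fun i => f t i)}

/-- Big cell: the orthogonal projection `W → H₊⁽ⁿ⁾` is bijective. -/
def InBigCell {n : ℕ} (W : Set (Hn n)) : Prop :=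
  ∀ g ∈ HPlus n, ∃! f : Hn n, f ∈ W ∧
    ∀ (i : Fin n) (k : ℤ), 0 ≤ k → vecCoeff f i k = vecCoeff g i k

/-- The doubly infinite sequence `a` is the Fourier series of a function in `Ξ(W) ⊆ H`, where `Ξ`
is the isometry `(f₀, …, fₙ₋₁) ↦ ∑ᵢ zⁱ fᵢ(zⁿ)`, i.e. the one that maps `e_{i,k}` to `z ^ (n k + i)`
(`i = 0, …, n - 1`). -/
def IsFourierOfMem {n : ℕ} (W : Set (Hn n)) (a : ℤ → ℂ) : Prop :=
  ∃ f ∈ W, ∀ (i : Fin n) (k : ℤ), vecCoeff f i k = a (n * k + (i : ℕ))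

/-! ## Formal pseudodifferential operators in `D = ∂ / ∂t₁` -/

/-- Formal power series in all the times `t₁, t₂, t₃, …`. -/
abbrev TimeRing : Type := MvPowerSeries ℕ+ ℂ

/-- The derivation `∂ / ∂t₁`. -/
def dt (f : TimeRing) : TimeRing := MvPowerSeries.pderiv ℂ (1 : ℕ+) f

theorem iterate_dt_zero (j : ℕ) : dt^[j] 0 = 0 :=
  Function.iterate_fixed (by simp [dt]) j

/-- A formal pseudodifferential operator `∑ₖ pₖ Dᵏ` (orders `k` bounded above). -/
@[ext]
structure PsiDO where
  coeff : ℤ → TimeRing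
  bdd : ∃ N : ℤ, ∀ k, N < k → coeff k = 0

namespace PsiDO

/-- The product, determined by `Dⁱ ∘ q = ∑ⱼ (i choose j) q⁽ʲ⁾ Dⁱ⁻ʲ` for `i ∈ ℤ`; for each order
`k` only finitely many pairs `(i, j)` contribute. -/
def mul (P Q : PsiDO) : PsiDO where
  coeff k := ∑ᶠ p : ℤ × ℕ,
    Ring.choose p.1 p.2 • (P.coeff p.1 * dt^[p.2] (Q.coeff (k - p.1 + p.2)))
  bdd := by
    obtain ⟨a, ha⟩ := P.bdd
    obtain ⟨b, hb⟩ := Q.bdd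
    refine ⟨a + b, fun k hk => finsum_eq_zero_of_forall_eq_zero fun p => ?_⟩
    by_cases h : a < p.1
    · simp [ha _ h]
    · rw [hb _ (by omega), iterate_dt_zero]
      simp

instance : Mul PsiDO := ⟨mul⟩

/-- The operator with constant coefficients `b(D)`, for `b(z) = ∑ₖ bₖ zᵏ` a Laurent series in
`1 / z`; in `LaurentSeries ℂ` the variable is `1 / z`, so `bₖ = b.coeff (-k)`. -/
def ofLaurent (b : LaurentSeries ℂ) : PsiDO where
  coeff k := MvPowerSeries.C (b.coeff (-k))
  bdd := ⟨-b.order, fun k hk => by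
    rw [HahnSeries.coeff_eq_zero_of_lt_order (by omega), map_zero]⟩

/-- `P ^ k`. -/
def npow (P : PsiDO) : ℕ → PsiDO
  | 0 => ofLaurent 1
  | k + 1 => npow P k * P

/-- `P` is a differential operator of order `m`. -/
def IsDiffOfOrder (P : PsiDO) (m : ℕ) : Prop :=
  P.coeff m ≠ 0 ∧ ∀ k : ℤ, k < 0 ∨ m < k → P.coeff k = 0

/-- `P` is of the form `1 + ∑_{i ≥ 1} sᵢ D⁻ⁱ`. -/
def IsMonicOfOrderZero (P : PsiDO) : Prop :=
  P.coeff 0 = 1 ∧ ∀ k : ℤ, 0 < k → P.coeff k = 0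

end PsiDO

/-- `F(L, M) = 0` for `F = ∑ F_{ij} xⁱ yʲ`, regarded as a polynomial in `y` over `ℂ[x]`. -/
def Annihilates (F : Polynomial (Polynomial ℂ)) (L M : PsiDO) : Prop :=
  ∀ k : ℤ, ∑ j ∈ F.support, ∑ i ∈ (F.coeff j).support,
    (F.coeff j).coeff i • (L.npow i * M.npow j).coeff k = 0

/-! ## The solution attached to `W` -/

/-- For `S = ∑ₖ sₖ Dᵏ`, the coefficient of `t ^ α z ^ l` in
`S exp(ξ(t, z)) = exp(ξ(t, z)) ∑ₖ sₖ(t) zᵏ`, where `ξ(t, z) = ∑_{i ≥ 1} tᵢ zⁱ`; the coefficient of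
`t ^ β` in `exp(ξ(t, z))` is `z ^ (∑ i βᵢ) / ∏ βᵢ!`. -/
def waveCoeff (S : PsiDO) (α : ℕ+ →₀ ℕ) (l : ℤ) : ℂ :=
  ∑ p ∈ Finset.HasAntidiagonal.antidiagonal α, (p.1.prod fun _ e => ((e.factorial : ℂ))⁻¹) *
    MvPowerSeries.coeff p.2 (S.coeff (l - ((p.1.sum fun i e => (i : ℕ) * e : ℕ) : ℤ)))

/-- `S` is the dressing operator of `W`: it is monic of order `0` and the wave function
`ψ_W(t; z) = S exp(ξ(t, z)) = exp(ξ(t, z)) (1 + O(1 / z))` takes its values in (the image under `Ξ`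
of) `W`; here it is expanded at `t = 0`. -/
def IsDressing {n : ℕ} (W : Set (Hn n)) (S : PsiDO) : Prop :=
  S.IsMonicOfOrderZero ∧ ∀ α : ℕ+ →₀ ℕ, IsFourierOfMem W (waveCoeff S α)

/-- `L = S Dⁿ S⁻¹` is the Lax operator of the solution attached to `W`, with dressing `S`. -/
def IsLax {n : ℕ} (W : Set (Hn n)) (S L : PsiDO) : Prop :=
  IsDressing W S ∧ L * S = S * PsiDO.ofLaurent (HahnSeries.single (-(n : ℤ)) 1)

/-- `W` is in the Burchnall-Chaundy locus: its Lax operator commutes with a differential operator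
of order `m`, where `m` is coprime to `n`. -/
def InBCLocus {n : ℕ} (W : Set (Hn n)) (m : ℕ) : Prop :=
  Nat.Coprime m n ∧ ∃ S L M : PsiDO, IsLax W S L ∧ M.IsDiffOfOrder m ∧ L * M = M * L

/-- Normalised data of a point in the Burchnall-Chaundy locus: `b(D) = S⁻¹ M S` for a Laurent series
`b(z) = z ^ m + …` in `1 / z` without any powers of `zⁿ`. -/
structure IsBCData {n : ℕ} (W : Set (Hn n)) (m : ℕ) (S L M : PsiDO) (b : LaurentSeries ℂ) :
    Prop where
  lax : IsLax W S L
  diff : M.IsDiffOfOrder m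
  comm : L * M = M * L
  conj : M * S = S * PsiDO.ofLaurent b
  lead : b.coeff (-(m : ℤ)) = 1
  order : ∀ k : ℤ, m < k → b.coeff (-k) = 0
  traceless : ∀ s : ℤ, b.coeff (-(n * s)) = 0

/-! ## Matrices of Laurent series in `1 / z` -/

/-- The element `z` of the field of Laurent series in `1 / z`. -/
def zVar : LaurentSeries ℂ := HahnSeries.single (-1) 1

/-- A loop without positive Fourier modes, as a matrix of series in `1 / z`. -/
def loopSeries {n : ℕ} (γ : MatLoop n) : Matrix (Fin n) (Fin n) (LaurentSeries ℂ) :=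
  Matrix.of fun i j =>
    ((PowerSeries.mk fun k : ℕ => loopCoeff γ (-(k : ℤ)) i j : PowerSeries ℂ) : LaurentSeries ℂ)

/-- The matrix `Λ`: ones below the diagonal, `z` in the upper right corner. -/
def Lam (n : ℕ) : Matrix (Fin n) (Fin n) (LaurentSeries ℂ) :=
  Matrix.of fun i j =>
    (if (i : ℕ) = j + 1 then 1 else 0) + (if (i : ℕ) = 0 ∧ (j : ℕ) + 1 = n then zVar else 0)

/-- `b(Λ) = ∑ₖ bₖ Λᵏ`. The entry `(i, j)` of `Λᵏ` is `z ^ q` if `k = n q + i - j` and is `0` if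
there is no such `q`, so that the coefficient of `z ^ q` in the entry `(i, j)` of `b(Λ)` is
`b_{n q + i - j}`. -/
def evalLam {n : ℕ} (b : LaurentSeries ℂ) : Matrix (Fin n) (Fin n) (LaurentSeries ℂ) :=
  Matrix.of fun i j => HahnSeries.ofSuppBddBelow
    (fun q : ℤ => b.coeff (n * q - (i : ℕ) + (j : ℕ))) (by
      refine ⟨min (b.order - n) 0, fun q hq => ?_⟩
      have h1 : b.order ≤ n * q - (i : ℕ) + (j : ℕ) := by
        by_contra h
        exact hq (HahnSeries.coeff_eq_zero_of_lt_order (not_le.mp h))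
      have hn : (1 : ℤ) ≤ n := by have := i.pos; omega
      have hj : ((j : ℕ) : ℤ) < n := by exact_mod_cast j.isLt
      by_contra hlt
      have h2 : q < b.order - n := lt_of_lt_of_le (not_le.mp hlt) (min_le_left _ _)
      have h3 : q < 0 := lt_of_lt_of_le (not_le.mp hlt) (min_le_right _ _)
      nlinarith)

theorem evalLam_coeff {n : ℕ} (b : LaurentSeries ℂ) (i j : Fin n) (q : ℤ) :
    (evalLam b i j).coeff q = b.coeff (n * q - (i : ℕ) + (j : ℕ)) := rfl

theorem coeff_zVar_mul (x : LaurentSeries ℂ) (q : ℤ) :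
    (zVar * x).coeff q = x.coeff (q + 1) := by
  have h := HahnSeries.coeff_single_mul_add (r := (1 : ℂ)) (x := x) (a := q + 1) (b := (-1 : ℤ))
  simpa [zVar] using h

theorem Lam_mul_evalLam {n : ℕ} (b : LaurentSeries ℂ) :
    Lam n * evalLam b = evalLam (zVar * b) := by
  ext i j q
  rw [evalLam_coeff, coeff_zVar_mul, Matrix.mul_apply]
  have hn : 0 < n := i.pos
  by_cases hi : (i : ℕ) = 0
  · rw [Finset.sum_eq_single (⟨n - 1, by omega⟩ : Fin n)]
    · have h : Lam n i ⟨n - 1, by omega⟩ = zVar := by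
        simp [Lam, hi]
        omega
      rw [h, coeff_zVar_mul, evalLam_coeff]
      congr 1
      push_cast [hi, Nat.cast_sub (Nat.succ_le_of_lt hn)]
      ring
    · intro l _ hl
      have : ¬ ((l : ℕ) + 1 = n) := fun h => hl (Fin.ext (by simp; omega))
      simp [Lam, hi, this]
    · simp
  · rw [Finset.sum_eq_single (⟨i - 1, by omega⟩ : Fin n)]
    · have h : Lam n i ⟨i - 1, by omega⟩ = 1 := by
        simp [Lam, hi]
        omega
      rw [h, one_mul, evalLam_coeff]
      congr 1
      push_cast [Nat.cast_sub (Nat.one_le_iff_ne_zero.mpr hi)]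
      ring
    · intro l _ hl
      have : ¬ ((i : ℕ) = l + 1) := fun h => hl (Fin.ext (by simp; omega))
      simp [Lam, hi, this]
    · simp

theorem evalLam_one {n : ℕ} : evalLam (1 : LaurentSeries ℂ) = (1 : Matrix (Fin n) (Fin n) _) := by
  ext i j q
  have hn : 0 < n := i.pos
  have hi : ((i : ℕ) : ℤ) < n := by exact_mod_cast i.isLt
  have hj : ((j : ℕ) : ℤ) < n := by exact_mod_cast j.isLt
  rw [evalLam_coeff, HahnSeries.coeff_one, Matrix.one_apply]
  by_cases hij : i = j
  · subst hij
    simp [HahnSeries.coeff_one, hn.ne']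
  · have : ¬ ((n : ℤ) * q - (i : ℕ) + (j : ℕ) = 0) := by
      intro h
      have hne : ((i : ℕ) : ℤ) ≠ (j : ℕ) := by
        intro h'
        exact hij (Fin.ext (by exact_mod_cast h'))
      have hq : q = 0 := by
        by_contra hq
        rcases lt_or_gt_of_ne hq with h0 | h0 <;> nlinarith
      subst hq
      omega
    simp [hij, this]

/-- The formula for `evalLam` does evaluate powers of `z` at the matrix `Λ`. -/
theorem evalLam_pow {n : ℕ} (k : ℕ) : evalLam (zVar ^ k) = Lam n ^ k := by
  induction k with
  | zero => simpa using evalLam_one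
  | succ k ih => rw [pow_succ', pow_succ', ← Lam_mul_evalLam, ih]

/-- A matrix over `ℂ[z]`, as a matrix of Laurent series in `1 / z`. -/
def polySeries {n : ℕ} (C : Matrix (Fin n) (Fin n) (Polynomial ℂ)) :
    Matrix (Fin n) (Fin n) (LaurentSeries ℂ) :=
  C.map fun p => Polynomial.aeval zVar p

end GelfandDickey

end

noncomputable section

namespace GelfandDickey

/-! Near `z = ∞` the loop is a matrix `Γ` of series in `1 / z`. Give `e_{i,k}` the degree `n k + i`
that it has under `Ξ`. An upper unitriangular constant plus `O(1 / z)` then preserves leading terms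
(`IsUnipotentAtInfty.coeff_top`). Hence `V = Ξ(Γ ℂ[z]ⁿ)` contains a monic series of every degree `N
≥ 0`, but no nonzero series with only negative powers of `z`. Big-cell uniqueness then forces every
element of `Ξ(W)` with finitely many positive powers into `V` (`mem_polySpace_of_isFourierOfMem`).
So the wave function `ψ` takes values in `V`, and its coefficients at `t₁ ^ k` span `V`.

A differential operator `M` keeps values in `V`. If `M S = S b(D)`, then `M ψ = b ψ`, so `b V ⊆ V`
(`stabilizes_of_conj`). Since `Ξ` turns multiplication by `b` into `b(Λ)`, this says that `Γ⁻¹ b(Λ)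
Γ` maps `ℂ[z]ⁿ` to itself, i.e. `C` is polynomial. Its trace is that of `b(Λ)`, which involves only
the `b_{ns}`; the degrees follow since `C e_j` has degree `m + j`.

For the curve, `F(L, M) S = S F(Dⁿ, b(D))` reduces relations to the kernel of `F ↦ F(zⁿ, b(z))`.
Cayley-Hamilton puts the characteristic polynomial in the kernel. Nothing nonzero of `λ`-degree
below `n` is there, because the degrees of the terms are distinct modulo `n` when `m` is coprime to
`n`. The kernel is thus generated by the characteristic polynomial, and it is prime because the
target is a field.

Existence of `b` needs more care: `S⁻¹ M S` commutes with `Dⁿ`, which makes it free of `t₁` but not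
of the other times. Each of its coefficients at a monomial in the times still stabilises `V`. One of
them with a nonzero `z ^ m` term is normalised, its powers of `zⁿ` are removed using the trace, and
the result is turned back into a differential operator by division by `S`. -/

theorem dt_add (f g : TimeRing) : dt (f + g) = dt f + dt g := map_add _ f g

theorem dt_zero : dt 0 = 0 := map_zero (MvPowerSeries.pderiv ℂ (1 : ℕ+))

theorem dt_zsmul (c : ℤ) (f : TimeRing) : dt (c • f) = c • dt f := map_zsmul _ c f

theorem dt_sum {ι : Type*} (s : Finset ι) (f : ι → TimeRing) :
    dt (∑ i ∈ s, f i) = ∑ i ∈ s, dt (f i) := map_sum _ f s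

theorem dt_mul (f g : TimeRing) : dt (f * g) = f * dt g + g * dt f :=
  Derivation.leibniz (MvPowerSeries.pderiv ℂ (1 : ℕ+)) f g

theorem dt_C (c : ℂ) : dt (MvPowerSeries.C c) = 0 := by
  have := Derivation.map_algebraMap (MvPowerSeries.pderiv (σ := ℕ+) ℂ (1 : ℕ+)) c
  exact this

theorem iterate_dt_add (j : ℕ) (f g : TimeRing) : dt^[j] (f + g) = dt^[j] f + dt^[j] g := by
  induction j generalizing f g with
  | zero => rfl
  | succ j ih => rw [Function.iterate_succ_apply, dt_add, ih]; rfl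

theorem iterate_dt_of_dt_eq_zero {f : TimeRing} (hf : dt f = 0) {j : ℕ} (hj : j ≠ 0) :
    dt^[j] f = 0 := by
  obtain ⟨j, rfl⟩ := Nat.exists_eq_succ_of_ne_zero hj
  rw [Function.iterate_succ_apply, hf, iterate_dt_zero]

namespace PsiDO

/-! ### Additive structure -/

theorem exists_bound (P Q : PsiDO) :
    ∃ N : ℤ, (∀ k, N < k → P.coeff k = 0) ∧ ∀ k, N < k → Q.coeff k = 0 := by
  obtain ⟨a, ha⟩ := P.bdd
  obtain ⟨b, hb⟩ := Q.bdd
  exact ⟨max a b, fun k hk => ha k (lt_of_le_of_lt (le_max_left _ _) hk),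
    fun k hk => hb k (lt_of_le_of_lt (le_max_right _ _) hk)⟩

instance : Zero PsiDO := ⟨⟨fun _ => 0, 0, fun _ _ => rfl⟩⟩

instance : Add PsiDO := ⟨fun P Q => ⟨fun k => P.coeff k + Q.coeff k, by
  obtain ⟨N, h1, h2⟩ := exists_bound P Q
  exact ⟨N, fun k hk => by rw [h1 k hk, h2 k hk, add_zero]⟩⟩⟩

instance : SMul TimeRing PsiDO := ⟨fun a P => ⟨fun k => a * P.coeff k, by
  obtain ⟨N, h⟩ := P.bdd
  exact ⟨N, fun k hk => by rw [h k hk, mul_zero]⟩⟩⟩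

instance : Neg PsiDO := ⟨fun P => ⟨fun k => -P.coeff k, by
  obtain ⟨N, h⟩ := P.bdd
  exact ⟨N, fun k hk => by rw [h k hk, neg_zero]⟩⟩⟩

instance : Sub PsiDO := ⟨fun P Q => ⟨fun k => P.coeff k - Q.coeff k, by
  obtain ⟨N, h1, h2⟩ := exists_bound P Q
  exact ⟨N, fun k hk => by rw [h1 k hk, h2 k hk, sub_zero]⟩⟩⟩

instance : SMul ℕ PsiDO := ⟨fun c P => ⟨fun k => c • P.coeff k, by
  obtain ⟨N, h⟩ := P.bdd
  exact ⟨N, fun k hk => by rw [h k hk, smul_zero]⟩⟩⟩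

instance : SMul ℤ PsiDO := ⟨fun c P => ⟨fun k => c • P.coeff k, by
  obtain ⟨N, h⟩ := P.bdd
  exact ⟨N, fun k hk => by rw [h k hk, smul_zero]⟩⟩⟩

theorem coeff_injective : Function.Injective PsiDO.coeff := fun _ _ h => PsiDO.ext h

instance : AddCommGroup PsiDO :=
  coeff_injective.addCommGroup PsiDO.coeff rfl (fun _ _ => rfl) (fun _ => rfl) (fun _ _ => rfl)
    (fun _ _ => rfl) (fun _ _ => rfl)

@[simp] theorem coeff_zero (k : ℤ) : (0 : PsiDO).coeff k = 0 := rfl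
@[simp] theorem coeff_add (P Q : PsiDO) (k : ℤ) : (P + Q).coeff k = P.coeff k + Q.coeff k := rfl
@[simp] theorem coeff_sub (P Q : PsiDO) (k : ℤ) : (P - Q).coeff k = P.coeff k - Q.coeff k := rfl
@[simp] theorem coeff_smul (a : TimeRing) (P : PsiDO) (k : ℤ) :
    (a • P).coeff k = a * P.coeff k := rfl

/-- Taking the coefficient of `Dᵏ`, as an additive map. -/
def coeffHom (k : ℤ) : PsiDO →+ TimeRing where
  toFun P := P.coeff k
  map_zero' := rfl
  map_add' _ _ := rfl

theorem coeff_sum {ι : Type*} (s : Finset ι) (f : ι → PsiDO) (k : ℤ) :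
    (∑ i ∈ s, f i).coeff k = ∑ i ∈ s, (f i).coeff k := map_sum (coeffHom k) f s

/-! ### Multiplication -/

/-- The operator `Dⁱ`. -/
def Dpow (i : ℤ) : PsiDO where
  coeff k := if k = i then 1 else 0
  bdd := ⟨i, fun k hk => if_neg (by omega)⟩

theorem coeff_Dpow (i k : ℤ) : (Dpow i).coeff k = if k = i then 1 else 0 := rfl

theorem coeff_mul_eq_sum {P Q : PsiDO} {a b k lo : ℤ} {T : ℕ}
    (hP : ∀ i, a < i → P.coeff i = 0) (hQ : ∀ i, b < i → Q.coeff i = 0)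
    (hlo : lo ≤ k - b) (hT : a + b - k < T) :
    (P * Q).coeff k = ∑ i ∈ Finset.Icc lo a, ∑ j ∈ Finset.range T,
      Ring.choose i j • (P.coeff i * dt^[j] (Q.coeff (k - i + j))) := by
  rw [← Finset.sum_product']
  change ∑ᶠ p : ℤ × ℕ, _ = _
  refine finsum_eq_sum_of_support_subset _ fun p hp => ?_
  have h1 : P.coeff p.1 ≠ 0 := fun h => hp (by simp [h])
  have h2 : Q.coeff (k - p.1 + p.2) ≠ 0 := fun h => hp (by simp [h, iterate_dt_zero])
  have h3 : p.1 ≤ a := not_lt.mp fun h => h1 (hP _ h)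
  have h4 : k - p.1 + p.2 ≤ b := not_lt.mp fun h => h2 (hQ _ h)
  simp only [Finset.coe_product, Set.mem_prod, Finset.mem_coe, Finset.mem_Icc, Finset.mem_range]
  omega

theorem coeff_Dpow_mul {Q : PsiDO} {b i k : ℤ} {T : ℕ} (hQ : ∀ i, b < i → Q.coeff i = 0)
    (hT : i + b - k < T) :
    (Dpow i * Q).coeff k =
      ∑ j ∈ Finset.range T, Ring.choose i j • dt^[j] (Q.coeff (k - i + j)) := by
  rw [coeff_mul_eq_sum (a := i) (lo := min i (k - b)) (T := T)
    (fun l hl => if_neg (by omega)) hQ (min_le_right _ _) hT, Finset.sum_eq_single i]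
  · simp [coeff_Dpow]
  · intro l _ hl
    simp [coeff_Dpow, hl]
  · intro h
    simp at h

theorem coeff_Dpow_mul_eq_zero {Q : PsiDO} {b i k : ℤ} (hQ : ∀ i, b < i → Q.coeff i = 0)
    (hk : i + b < k) : (Dpow i * Q).coeff k = 0 := by
  rw [coeff_Dpow_mul (T := 0) hQ (by simp; omega), Finset.sum_range_zero]

theorem coeff_Dpow_mul_top {Q : PsiDO} {b i : ℤ} (hQ : ∀ i, b < i → Q.coeff i = 0) :
    (Dpow i * Q).coeff (i + b) = Q.coeff b := by
  rw [coeff_Dpow_mul (T := 1) hQ (by simp), Finset.sum_range_one]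
  simp

/-- Left multiplication by a function involves no derivatives, so every product reduces to the
products `Dpow i * Q`; the ring axioms are checked on these. -/
theorem coeff_mul {P Q : PsiDO} {a b k lo : ℤ}
    (hP : ∀ i, a < i → P.coeff i = 0) (hQ : ∀ i, b < i → Q.coeff i = 0) (hlo : lo ≤ k - b) :
    (P * Q).coeff k = ∑ i ∈ Finset.Icc lo a, P.coeff i * (Dpow i * Q).coeff k := by
  rw [coeff_mul_eq_sum (T := (a + b - k + 1).toNat) hP hQ hlo (by omega)]
  refine Finset.sum_congr rfl fun i hi => ?_
  rw [coeff_Dpow_mul (T := (a + b - k + 1).toNat) hQ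
    (by have := (Finset.mem_Icc.mp hi).2; omega), Finset.mul_sum]
  exact Finset.sum_congr rfl fun j _ => (mul_smul_comm _ _ _).symm

theorem coeff_mul_eq_zero {P Q : PsiDO} {a b k : ℤ}
    (hP : ∀ i, a < i → P.coeff i = 0) (hQ : ∀ i, b < i → Q.coeff i = 0) (hk : a + b < k) :
    (P * Q).coeff k = 0 := by
  rw [coeff_mul hP hQ le_rfl, Finset.Icc_eq_empty (by omega), Finset.sum_empty]

theorem coeff_mul_top {P Q : PsiDO} {a b : ℤ}
    (hP : ∀ i, a < i → P.coeff i = 0) (hQ : ∀ i, b < i → Q.coeff i = 0) :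
    (P * Q).coeff (a + b) = P.coeff a * Q.coeff b := by
  rw [coeff_mul hP hQ (lo := a) (by omega), Finset.Icc_self, Finset.sum_singleton,
    coeff_Dpow_mul_top hQ]

theorem Dpow_mul_add (i : ℤ) (Q R : PsiDO) : Dpow i * (Q + R) = Dpow i * Q + Dpow i * R := by
  obtain ⟨N, hQ, hR⟩ := exists_bound Q R
  ext1; funext k
  have hQR : ∀ l, N < l → (Q + R).coeff l = 0 := fun l hl => by simp [hQ l hl, hR l hl]
  have hT : i + N - k < ((i + N - k + 1).toNat : ℤ) := by omega
  rw [coeff_add, coeff_Dpow_mul hQR hT, coeff_Dpow_mul hQ hT, coeff_Dpow_mul hR hT,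
    ← Finset.sum_add_distrib]
  exact Finset.sum_congr rfl fun j _ => by rw [coeff_add, iterate_dt_add, smul_add]

protected theorem mul_add (P Q R : PsiDO) : P * (Q + R) = P * Q + P * R := by
  obtain ⟨N, hQ, hR⟩ := exists_bound Q R
  obtain ⟨a, hP⟩ := P.bdd
  have hQR : ∀ l, N < l → (Q + R).coeff l = 0 := fun l hl => by simp [hQ l hl, hR l hl]
  ext1; funext k
  rw [coeff_add, coeff_mul hP hQ le_rfl, coeff_mul hP hR le_rfl, coeff_mul hP hQR le_rfl,
    ← Finset.sum_add_distrib]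
  exact Finset.sum_congr rfl fun i _ => by rw [Dpow_mul_add, coeff_add, mul_add]

protected theorem add_mul (P Q R : PsiDO) : (P + Q) * R = P * R + Q * R := by
  obtain ⟨N, hP, hQ⟩ := exists_bound P Q
  obtain ⟨b, hR⟩ := R.bdd
  have hPQ : ∀ l, N < l → (P + Q).coeff l = 0 := fun l hl => by simp [hP l hl, hQ l hl]
  ext1; funext k
  rw [coeff_add, coeff_mul hP hR le_rfl, coeff_mul hQ hR le_rfl, coeff_mul hPQ hR le_rfl,
    ← Finset.sum_add_distrib]
  exact Finset.sum_congr rfl fun i _ => by rw [coeff_add, add_mul]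

protected theorem smul_mul (c : TimeRing) (P Q : PsiDO) : (c • P) * Q = c • (P * Q) := by
  obtain ⟨a, hP⟩ := P.bdd
  obtain ⟨b, hQ⟩ := Q.bdd
  have hcP : ∀ l, a < l → (c • P).coeff l = 0 := fun l hl => by simp [hP l hl]
  ext1; funext k
  rw [coeff_smul, coeff_mul hP hQ le_rfl, coeff_mul hcP hQ le_rfl, Finset.mul_sum]
  exact Finset.sum_congr rfl fun i _ => by rw [coeff_smul, mul_assoc]

theorem coeff_Dpow_mul_of_dt_eq_zero {Q : PsiDO} (hQ : ∀ k, dt (Q.coeff k) = 0) (i k : ℤ) :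
    (Dpow i * Q).coeff k = Q.coeff (k - i) := by
  obtain ⟨b, hb⟩ := Q.bdd
  rw [coeff_Dpow_mul (T := (i + b - k + 1).toNat + 1) hb (by push_cast; omega),
    Finset.sum_range_succ', Finset.sum_eq_zero]
  · simp
  · intro j _
    rw [iterate_dt_of_dt_eq_zero (hQ _) j.succ_ne_zero, smul_zero]

theorem coeff_mul_of_dt_eq_zero {P Q : PsiDO} (hQ0 : ∀ k, dt (Q.coeff k) = 0) {a b k lo : ℤ}
    (hP : ∀ i, a < i → P.coeff i = 0) (hQ : ∀ i, b < i → Q.coeff i = 0) (hlo : lo ≤ k - b) :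
    (P * Q).coeff k = ∑ i ∈ Finset.Icc lo a, P.coeff i * Q.coeff (k - i) := by
  rw [coeff_mul hP hQ hlo]
  exact Finset.sum_congr rfl fun i _ => by rw [coeff_Dpow_mul_of_dt_eq_zero hQ0]

theorem dt_coeff_Dpow (i k : ℤ) : dt ((Dpow i).coeff k) = 0 := by
  rw [coeff_Dpow]
  split_ifs
  · simpa using dt_C 1
  · exact dt_zero

theorem coeff_mul_Dpow (P : PsiDO) (i k : ℤ) : (P * Dpow i).coeff k = P.coeff (k - i) := by
  obtain ⟨a, hP⟩ := P.bdd
  rw [coeff_mul_of_dt_eq_zero (dt_coeff_Dpow i) hP (b := i) (lo := min (k - i) a)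
    (fun l hl => if_neg (by omega)) (min_le_left _ _)]
  by_cases h : k - i ≤ a
  · rw [Finset.sum_eq_single (k - i)]
    · simp [coeff_Dpow]
    · intro l _ hl
      rw [coeff_Dpow, if_neg (by omega), mul_zero]
    · intro h'
      simp [h] at h'
  · rw [hP _ (by omega)]
    refine Finset.sum_eq_zero fun l hl => ?_
    rw [coeff_Dpow, if_neg (by have := (Finset.mem_Icc.mp hl).2; omega), mul_zero]

theorem coeff_D_mul (Q : PsiDO) (k : ℤ) :
    (Dpow 1 * Q).coeff k = Q.coeff (k - 1) + dt (Q.coeff k) := by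
  obtain ⟨b, hb⟩ := Q.bdd
  rw [coeff_Dpow_mul (T := (1 + b - k + 1).toNat + 2) hb (by push_cast; omega),
    Finset.sum_range_succ', Finset.sum_range_succ', Finset.sum_eq_zero]
  · simp [add_comm]
  · intro j _
    have : Ring.choose (1 : ℤ) (j + 1 + 1) = 0 := by
      have := Ring.choose_natCast (R := ℤ) 1 (j + 1 + 1)
      simpa [Nat.choose_eq_zero_of_lt] using this
    rw [this, zero_smul]

/-- Pascal's rule for the generalised binomial coefficients. -/
theorem D_mul_Dpow_mul (i : ℤ) (Q : PsiDO) : Dpow 1 * (Dpow i * Q) = Dpow (i + 1) * Q := by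
  obtain ⟨b, hb⟩ := Q.bdd
  ext1; funext k
  set T := (i + b - k + 1).toNat with hT
  rw [coeff_D_mul, coeff_Dpow_mul (T := T + 1) hb (by push_cast; omega),
    coeff_Dpow_mul (T := T) hb (by omega), coeff_Dpow_mul (T := T + 1) hb (by push_cast; omega),
    dt_sum, Finset.sum_range_succ', Finset.sum_range_succ', add_right_comm,
    ← Finset.sum_add_distrib]
  congr 1
  · refine Finset.sum_congr rfl fun j _ => ?_
    rw [dt_zsmul, ← Function.iterate_succ_apply' dt, Ring.choose_succ_succ, add_smul, add_comm]
    congr 4 <;> push_cast <;> ring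
  · simp
    ring_nf

/-- The Leibniz rule applied to `Q.coeff i * (Dpow i * R).coeff k`, followed by a shift of the
summation index. -/
theorem D_mul_mul (Q R : PsiDO) : Dpow 1 * (Q * R) = (Dpow 1 * Q) * R := by
  obtain ⟨a, hQ⟩ := Q.bdd
  obtain ⟨b, hR⟩ := R.bdd
  have hDQ : ∀ l, a + 1 < l → (Dpow 1 * Q).coeff l = 0 := fun l hl =>
    coeff_Dpow_mul_eq_zero hQ (by omega)
  have hQ' : ∀ l, a + 1 < l → Q.coeff l = 0 := fun l hl => hQ l (by omega)
  ext1; funext k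
  rw [coeff_D_mul, coeff_mul (k := k - 1) hQ hR (lo := k - 1 - b) le_rfl,
    coeff_mul (k := k) hQ' hR (lo := k - 1 - b) (by omega),
    coeff_mul hDQ hR (lo := k - 1 - b) (by omega),
    dt_sum]
  have h1 : ∀ i, (Dpow 1 * Q).coeff i * (Dpow i * R).coeff k =
      Q.coeff (i - 1) * (Dpow i * R).coeff k + dt (Q.coeff i) * (Dpow i * R).coeff k := fun i => by
    rw [coeff_D_mul, add_mul]
  have h2 : ∀ i, dt (Q.coeff i * (Dpow i * R).coeff k) =
      dt (Q.coeff i) * (Dpow i * R).coeff k + Q.coeff i * dt ((Dpow i * R).coeff k) := fun i => by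
    rw [dt_mul]; ring
  have h3 : ∀ i, Q.coeff i * (Dpow (i + 1) * R).coeff k =
      Q.coeff i * (Dpow i * R).coeff (k - 1) + Q.coeff i * dt ((Dpow i * R).coeff k) := fun i => by
    rw [← D_mul_Dpow_mul, coeff_D_mul, mul_add]
  -- The shift `i ↦ i + 1` moves the ends of the interval; the extra terms vanish for reasons of
  -- order.
  have h4 : ∑ i ∈ Finset.Icc (k - 1 - b) (a + 1), Q.coeff (i - 1) * (Dpow i * R).coeff k =
      ∑ i ∈ Finset.Icc (k - 1 - b) (a + 1), Q.coeff i * (Dpow (i + 1) * R).coeff k := by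
    have e1 : ∑ i ∈ Finset.Icc (k - 1 - b) (a + 1), Q.coeff (i - 1) * (Dpow i * R).coeff k =
        ∑ i ∈ Finset.Icc (k - 1 - b - 1) a, Q.coeff i * (Dpow (i + 1) * R).coeff k := by
      refine Finset.sum_nbij' (fun i => i - 1) (fun i => i + 1) ?_ ?_ ?_ ?_ ?_
      · intro i hi; simp only [Finset.mem_Icc] at hi ⊢; omega
      · intro i hi; simp only [Finset.mem_Icc] at hi ⊢; omega
      · intro i _; simp
      · intro i _; simp
      · intro i _; simp
    rw [e1]
    trans ∑ i ∈ Finset.Icc (k - 1 - b) a, Q.coeff i * (Dpow (i + 1) * R).coeff k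
    · refine (Finset.sum_subset (fun i hi => ?_) fun i hi hi' => ?_).symm
      · simp only [Finset.mem_Icc] at hi ⊢; omega
      · simp only [Finset.mem_Icc] at hi hi'
        rw [coeff_Dpow_mul_eq_zero hR (by omega), mul_zero]
    · refine Finset.sum_subset (fun i hi => ?_) fun i hi hi' => ?_
      · simp only [Finset.mem_Icc] at hi ⊢; omega
      · simp only [Finset.mem_Icc] at hi hi'
        rw [hQ _ (by omega), zero_mul]
  have h5 : ∑ i ∈ Finset.Icc (k - 1 - b) a, Q.coeff i * (Dpow i * R).coeff (k - 1) =
      ∑ i ∈ Finset.Icc (k - 1 - b) (a + 1), Q.coeff i * (Dpow i * R).coeff (k - 1) := by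
    refine Finset.sum_subset (fun i hi => ?_) fun i hi hi' => ?_
    · simp only [Finset.mem_Icc] at hi ⊢; omega
    · simp only [Finset.mem_Icc] at hi hi'
      rw [hQ _ (by omega), zero_mul]
  simp only [h1, h2, Finset.sum_add_distrib, h4, h3, h5]
  ring

/-- The equation `Q.coeff (k - 1) = -dt (Q.coeff k)` propagates zero downwards from above the order
of `Q`. -/
theorem eq_zero_of_D_mul_eq_zero {Q : PsiDO} (h : Dpow 1 * Q = 0) : Q = 0 := by
  obtain ⟨b, hb⟩ := Q.bdd
  have key : ∀ d : ℕ, Q.coeff (b + 1 - d) = 0 := by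
    intro d
    induction d with
    | zero => exact hb _ (by simp)
    | succ d ih =>
      have h1 := coeff_D_mul Q (b + 1 - d)
      rw [h, ih, dt_zero, add_zero, coeff_zero] at h1
      rw [h1]
      congr 1
      push_cast
      ring
  ext1; funext k
  rcases lt_or_ge b k with hk | hk
  · exact hb k hk
  · rw [show k = b + 1 - ((b + 1 - k).toNat : ℕ) by omega, key]
    rfl

protected theorem mul_zero (P : PsiDO) : P * 0 = 0 := by
  have := PsiDO.mul_add P 0 0
  rw [add_zero] at this
  exact left_eq_add.mp this

protected theorem zero_mul (P : PsiDO) : 0 * P = 0 := by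
  have := PsiDO.add_mul 0 0 P
  rw [add_zero] at this
  exact left_eq_add.mp this

protected theorem mul_neg (P Q : PsiDO) : P * (-Q) = -(P * Q) := by
  rw [eq_neg_iff_add_eq_zero, ← PsiDO.mul_add, neg_add_cancel, PsiDO.mul_zero]

theorem D_mul_left_injective {Q R : PsiDO} (h : Dpow 1 * Q = Dpow 1 * R) : Q = R := by
  rw [← sub_eq_zero]
  apply eq_zero_of_D_mul_eq_zero
  rw [sub_eq_add_neg, PsiDO.mul_add, PsiDO.mul_neg, h, add_neg_cancel]

theorem ofLaurent_one : ofLaurent 1 = Dpow 0 := by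
  ext1; funext k
  change MvPowerSeries.C ((1 : LaurentSeries ℂ).coeff (-k)) = if k = 0 then 1 else 0
  rw [HahnSeries.coeff_one]
  by_cases h : k = 0 <;> simp [h]

protected theorem Dpow_zero_mul (P : PsiDO) : Dpow 0 * P = P := by
  obtain ⟨b, hb⟩ := P.bdd
  ext1; funext k
  rw [coeff_Dpow_mul (T := (0 + b - k + 1).toNat + 1) hb (by push_cast; omega),
    Finset.sum_range_succ', Finset.sum_eq_zero]
  · simp
  · intro j _
    rw [Ring.choose_zero_succ, zero_smul]

/-- Upwards in `i` this iterates `D_mul_mul`; downwards, a factor `D` on the left is cancelled.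
Associativity follows by linearity in the left factor. -/
theorem Dpow_mul_mul (i : ℤ) (Q R : PsiDO) : Dpow i * (Q * R) = (Dpow i * Q) * R := by
  induction i using Int.induction_on with
  | zero => rw [PsiDO.Dpow_zero_mul, PsiDO.Dpow_zero_mul]
  | succ i ih => rw [← D_mul_Dpow_mul, ih, D_mul_mul, D_mul_Dpow_mul]
  | pred i ih =>
    apply D_mul_left_injective
    rw [D_mul_Dpow_mul, D_mul_mul, D_mul_Dpow_mul, sub_add_cancel, ih]

protected theorem mul_assoc (P Q R : PsiDO) : P * Q * R = P * (Q * R) := by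
  obtain ⟨a, hP⟩ := P.bdd
  obtain ⟨b, hQ⟩ := Q.bdd
  obtain ⟨c, hR⟩ := R.bdd
  ext1; funext k
  have hPQ : ∀ l, a + b < l → (P * Q).coeff l = 0 := fun l hl => coeff_mul_eq_zero hP hQ hl
  have hQR : ∀ l, b + c < l → (Q * R).coeff l = 0 := fun l hl => coeff_mul_eq_zero hQ hR hl
  rw [coeff_mul hPQ hR le_rfl, coeff_mul hP hQR le_rfl]
  have h1 : ∀ l ∈ Finset.Icc (k - c) (a + b), (P * Q).coeff l * (Dpow l * R).coeff k =
      ∑ i ∈ Finset.Icc (k - (b + c)) a,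
        P.coeff i * ((Dpow i * Q).coeff l * (Dpow l * R).coeff k) := by
    intro l hl
    rw [coeff_mul hP hQ (lo := k - (b + c)) (by have := (Finset.mem_Icc.mp hl).1; omega),
      Finset.sum_mul]
    simp only [mul_assoc]
  rw [Finset.sum_congr rfl h1, Finset.sum_comm]
  refine Finset.sum_congr rfl fun i hi => ?_
  have hi' := (Finset.mem_Icc.mp hi).2
  have hDQ : ∀ l, a + b < l → (Dpow i * Q).coeff l = 0 := fun l hl =>
    coeff_Dpow_mul_eq_zero hQ (by omega)
  rw [Dpow_mul_mul, coeff_mul hDQ hR le_rfl, Finset.mul_sum]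

instance : One PsiDO := ⟨ofLaurent 1⟩

theorem one_eq_Dpow : (1 : PsiDO) = Dpow 0 := ofLaurent_one

instance : Ring PsiDO where
  __ := (inferInstance : AddCommGroup PsiDO)
  mul_assoc := PsiDO.mul_assoc
  one_mul P := by rw [one_eq_Dpow, PsiDO.Dpow_zero_mul]
  mul_one P := by ext1; funext k; rw [one_eq_Dpow, coeff_mul_Dpow, sub_zero]
  left_distrib := PsiDO.mul_add
  right_distrib := PsiDO.add_mul
  zero_mul := PsiDO.zero_mul
  mul_zero := PsiDO.mul_zero

theorem npow_eq_pow (P : PsiDO) (k : ℕ) : P.npow k = P ^ k := by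
  induction k with
  | zero => rw [pow_zero]; rfl
  | succ k ih => rw [pow_succ, ← ih]; rfl

/-! ### Division by a monic operator -/

theorem exists_top {P : PsiDO} (hP : P ≠ 0) :
    ∃ a, P.coeff a ≠ 0 ∧ ∀ i, a < i → P.coeff i = 0 := by
  obtain ⟨N, hN⟩ := P.bdd
  have hne : ∃ k, P.coeff k ≠ 0 := by
    by_contra! h
    exact hP (by ext1; funext k; exact h k)
  obtain ⟨a, ha, hmax⟩ := Int.exists_greatest_of_bdd (P := fun k => P.coeff k ≠ 0)
    ⟨N, fun k hk => not_lt.mp fun h => hk (hN k h)⟩ hne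
  exact ⟨a, ha, fun i hi => by_contra fun h => absurd (hmax i h) (not_le.mpr hi)⟩

/-- Leading coefficients multiply, and that of `S` is `1`. Such cancellations, together with left
and right division, replace an explicit `S⁻¹`. -/
theorem IsMonicOfOrderZero.mul_left_eq_zero {S X : PsiDO} (hS : S.IsMonicOfOrderZero)
    (h : X * S = 0) : X = 0 := by
  by_contra hX
  obtain ⟨a, ha, ha'⟩ := exists_top hX
  apply ha
  have := coeff_mul_top ha' hS.2
  rwa [h, hS.1, mul_one, coeff_zero, eq_comm] at this

theorem IsMonicOfOrderZero.mul_right_eq_zero {S X : PsiDO} (hS : S.IsMonicOfOrderZero)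
    (h : S * X = 0) : X = 0 := by
  by_contra hX
  obtain ⟨a, ha, ha'⟩ := exists_top hX
  apply ha
  have := coeff_mul_top hS.2 ha'
  rwa [h, hS.1, one_mul, coeff_zero, eq_comm] at this

/-- Right division by a monic operator of order zero. -/
theorem IsMonicOfOrderZero.exists_right_quotient {S : PsiDO} (hS : S.IsMonicOfOrderZero) (N : ℕ) :
    ∀ T : PsiDO, (∀ k : ℤ, N ≤ k → T.coeff k = 0) →
      ∃ M : PsiDO, (∀ k : ℤ, k < 0 ∨ N ≤ k → M.coeff k = 0) ∧
        ∀ k : ℤ, 0 ≤ k → (T - M * S).coeff k = 0 := by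
  induction N with
  | zero =>
    exact fun T hT => ⟨0, fun _ _ => rfl, fun k hk => by simpa using hT k (by simpa using hk)⟩
  | succ N ih =>
    intro T hT
    -- Since `S` is monic of order `0`, subtracting this multiple of `S` removes exactly the top
    -- term of `T`.
    obtain ⟨M, hM, hM'⟩ := ih (T - (T.coeff N • Dpow N) * S) fun k hk => by
      rw [coeff_sub, PsiDO.smul_mul, coeff_smul]
      rcases eq_or_lt_of_le hk with rfl | hk
      · have := coeff_Dpow_mul_top (i := N) hS.2
        rw [add_zero] at this
        rw [this, hS.1, mul_one, sub_self]
      · rw [hT k (by push_cast; omega), coeff_Dpow_mul_eq_zero hS.2 (by omega), mul_zero, sub_zero]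
    refine ⟨M + T.coeff N • Dpow N, fun k hk => ?_, fun k hk => ?_⟩
    · rw [coeff_add, hM k (by push_cast at hk; omega), coeff_smul, coeff_Dpow,
        if_neg (by push_cast at hk; omega), mul_zero, add_zero]
    · rw [add_mul, add_comm, ← sub_sub]
      exact hM' k hk

/-- Left division by a monic operator of order zero. -/
theorem IsMonicOfOrderZero.exists_left_quotient {S : PsiDO} (hS : S.IsMonicOfOrderZero)
    (Q : PsiDO) : ∃ P : PsiDO, S * P = Q := by
  obtain ⟨q, hq⟩ := Q.bdd
  -- Successive approximation from the top: `f d` leaves a remainder of order at most `q - d`, and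
  -- its leading term is added to form `f (d + 1)`.
  let f : ℕ → PsiDO := fun d => Nat.rec 0
    (fun d F => F + (Q - S * F).coeff (q - d) • Dpow (q - d)) d
  have f_succ : ∀ d, f (d + 1) = f d + (Q - S * f d).coeff (q - d) • Dpow (q - d) := fun d => rfl
  have hrem : ∀ d : ℕ, ∀ k, q - d < k → (Q - S * f d).coeff k = 0 := by
    intro d
    induction d with
    | zero => intro k hk; simpa [f] using hq k (by simpa using hk)
    | succ d ih =>
      intro k hk
      set c := (Q - S * f d).coeff (q - d) with hc
      have hX : ∀ l, q - d < l → (c • Dpow (q - d)).coeff l = 0 := fun l hl => by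
        rw [coeff_smul, coeff_Dpow, if_neg (by omega), mul_zero]
      rw [f_succ, mul_add, ← sub_sub, coeff_sub]
      rcases lt_or_ge (q - d) k with h | h
      · rw [ih k h, coeff_mul_eq_zero hS.2 hX (by omega), sub_zero]
      · have hk' : k = 0 + (q - d) := by push_cast at hk; omega
        rw [hk', coeff_mul_top hS.2 hX, hS.1, zero_add, coeff_smul, coeff_Dpow, if_pos rfl,
          mul_one, one_mul, ← hc, sub_self]
  have hstab : ∀ (k : ℤ) (d e : ℕ), q - d < k → (f (d + e)).coeff k = (f d).coeff k := by
    intro k d e hk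
    induction e with
    | zero => rfl
    | succ e ih =>
      rw [← add_assoc, f_succ, coeff_add, ih, coeff_smul, coeff_Dpow,
        if_neg (by push_cast; omega), mul_zero, add_zero]
  -- The coefficient of `Dᵏ` no longer changes once `q - d < k`, so the limit can be read off at `d
  -- = q - k + 1`.
  let P : PsiDO := ⟨fun k => (f (q - k + 1).toNat).coeff k, q, fun k hk => by
    rw [show (q - k + 1).toNat = 0 by omega]; rfl⟩
  have hPf : ∀ (k : ℤ) (d : ℕ), q - d < k → P.coeff k = (f d).coeff k := by
    intro k d hk
    change (f (q - k + 1).toNat).coeff k = _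
    obtain ⟨e, he⟩ := Nat.exists_eq_add_of_le (show (q - k + 1).toNat ≤ d by omega)
    rw [he, hstab]
    omega
  refine ⟨P, ?_⟩
  rw [eq_comm, ← sub_eq_zero]
  ext1; funext k
  set d := (q - k + 1).toNat with hd
  have h1 : Q - S * P = (Q - S * f d) - S * (P - f d) := by rw [mul_sub]; abel
  rw [h1, coeff_sub, hrem d k (by omega), coeff_mul_eq_zero hS.2 (b := q - d) _ (by omega)]
  · simp
  · intro l hl
    rw [coeff_sub, hPf l d hl, sub_self]

/-! ### Constant coefficients -/

theorem coeff_ofLaurent (b : LaurentSeries ℂ) (k : ℤ) :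
    (ofLaurent b).coeff k = MvPowerSeries.C (b.coeff (-k)) := rfl

theorem dt_coeff_ofLaurent (b : LaurentSeries ℂ) (k : ℤ) : dt ((ofLaurent b).coeff k) = 0 :=
  dt_C _

theorem ofLaurent_single (n : ℤ) : ofLaurent (HahnSeries.single (-n) 1) = Dpow n := by
  ext1; funext k
  rw [coeff_ofLaurent, coeff_Dpow, HahnSeries.coeff_single]
  by_cases h : k = n <;> simp [h]

/-- The centraliser of `Dⁿ` consists of operators whose coefficients do not depend on `t₁`. -/
theorem dt_coeff_eq_zero_of_commute {n : ℕ} (hn : n ≠ 0) {P : PsiDO}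
    (h : Dpow n * P = P * Dpow n) (k : ℤ) : dt (P.coeff k) = 0 := by
  obtain ⟨b, hb⟩ := P.bdd
  have key : ∀ (d : ℕ) (k : ℤ), b - d < k → dt (P.coeff k) = 0 := by
    intro d
    induction d with
    | zero => intro k hk; rw [hb k (by simpa using hk), dt_zero]
    | succ d ih =>
      intro k hk
      rcases lt_or_ge (b - d) k with h1 | h1
      · exact ih k h1
      -- If all coefficients above order `k` are free of `t₁`, the coefficient of order `n + k - 1`
      -- in `[Dⁿ, P]` is `n * dt (P.coeff k)`.
      have h2 : (Dpow n * P).coeff (n + k - 1) = (P * Dpow n).coeff (n + k - 1) := by rw [h]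
      rw [coeff_mul_Dpow, coeff_Dpow_mul (T := d + 2) hb (by push_cast at *; omega),
        Finset.sum_range_succ', Finset.sum_range_succ', Finset.sum_eq_zero] at h2
      · simp only [zero_add, Function.iterate_one, Ring.choose_one_right, Nat.cast_one,
          Ring.choose_zero_right, Function.iterate_zero, id, one_smul, Nat.cast_zero, add_zero,
          add_eq_right] at h2
        rw [show (n : ℤ) + k - 1 - n + 1 = k by ring] at h2
        have hn' : (n : ℤ) ≠ 0 := by exact_mod_cast hn
        ext α
        have h3 := congrArg (MvPowerSeries.coeff α) h2
        rw [map_zsmul, map_zero] at h3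
        exact (smul_eq_zero.mp h3).resolve_left hn'
      · intro j _
        rw [Function.iterate_succ_apply, ih _ (by push_cast at *; omega), iterate_dt_zero,
          smul_zero]
  exact key (b - k + 1).toNat k (by omega)

end PsiDO

/-! ### Wave functions and symbols -/

/-- The product of Laurent series as a finite sum over an interval. -/
theorem laurent_coeff_mul {x y : LaurentSeries ℂ} {k A B : ℤ} (hx : ∀ l < A, x.coeff l = 0)
    (hy : ∀ l < k - B, y.coeff l = 0) :
    (x * y).coeff k = ∑ u ∈ Finset.Icc A B, x.coeff u * y.coeff (k - u) := by
  rw [HahnSeries.coeff_mul]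
  refine Finset.sum_of_injOn Prod.fst ?_ ?_ ?_ ?_
  · rintro ⟨a, b⟩ h ⟨a', b'⟩ h' (rfl : a = a')
    simp only [Finset.mem_coe, Finset.mem_antidiagonal] at h h'
    ext
    · rfl
    · simp only; omega
  · rintro ⟨a, b⟩ h
    simp only [Finset.mem_coe, Finset.mem_antidiagonal, HahnSeries.mem_support] at h
    simp only [Finset.coe_Icc, Set.mem_Icc]
    constructor
    · by_contra h1
      exact h.1 (hx _ (by omega))
    · by_contra h1
      exact h.2.1 (hy _ (by omega))
  · intro u _ hu
    by_contra h
    refine hu ⟨(u, k - u), ?_, rfl⟩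
    simp only [Finset.mem_coe, Finset.mem_antidiagonal, HahnSeries.mem_support]
    exact ⟨left_ne_zero_of_mul h, right_ne_zero_of_mul h, by ring⟩
  · rintro ⟨a, b⟩ h
    simp only [Finset.mem_antidiagonal] at h
    simp only
    rw [← h.2.2, add_sub_cancel_left]

theorem laurent_exists_bound (x : LaurentSeries ℂ) : ∃ A : ℤ, ∀ l < A, x.coeff l = 0 :=
  ⟨x.order, fun _ hl => HahnSeries.coeff_eq_zero_of_lt_order hl⟩

/-- Formal power series in the times, with values in Laurent series in `1 / z`. -/
abbrev WaveRing : Type := MvPowerSeries ℕ+ (LaurentSeries ℂ)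

/-- The derivation `∂ / ∂t₁` of the ring of wave functions. -/
def dw : Derivation (LaurentSeries ℂ) WaveRing WaveRing := MvPowerSeries.pderiv _ (1 : ℕ+)

theorem coeff_dw (α : ℕ+ →₀ ℕ) (f : WaveRing) :
    MvPowerSeries.coeff α (dw f) =
      (α 1 + 1) • MvPowerSeries.coeff (α + Finsupp.single 1 1) f := by
  rw [dw, MvPowerSeries.coeff_pderiv, nsmul_eq_mul, mul_comm]
  push_cast
  rfl

/-- Series in the times as wave functions not depending on `z`. -/
def timeToWave : TimeRing →+* WaveRing := MvPowerSeries.map HahnSeries.C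

theorem coeff_timeToWave (α : ℕ+ →₀ ℕ) (f : TimeRing) :
    MvPowerSeries.coeff α (timeToWave f) = HahnSeries.C (MvPowerSeries.coeff α f) :=
  MvPowerSeries.coeff_map _ _ _

namespace PsiDO

/-- The symbol `∑ₖ pₖ zᵏ` of `∑ₖ pₖ Dᵏ`. -/
def symbol (P : PsiDO) : WaveRing := fun β =>
  HahnSeries.ofSuppBddBelow (fun l => MvPowerSeries.coeff β (P.coeff (-l))) (by
    obtain ⟨N, hN⟩ := P.bdd
    refine ⟨-N, fun l hl => ?_⟩
    by_contra h
    exact hl (by simp [hN (-l) (by omega)]))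

theorem coeff_symbol (P : PsiDO) (β : ℕ+ →₀ ℕ) (l : ℤ) :
    (MvPowerSeries.coeff β P.symbol).coeff l = MvPowerSeries.coeff β (P.coeff (-l)) := rfl

theorem symbol_injective : Function.Injective symbol := fun P Q h => by
  ext k α
  have := congrArg (fun f => (MvPowerSeries.coeff α f).coeff (-k)) h
  simpa [coeff_symbol] using this

theorem symbol_add (P Q : PsiDO) : (P + Q).symbol = P.symbol + Q.symbol := by
  ext α l
  simp [coeff_symbol]

theorem symbol_zero : (0 : PsiDO).symbol = 0 := by
  ext α l
  simp [coeff_symbol]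

theorem symbol_smul (a : TimeRing) (P : PsiDO) : (a • P).symbol = timeToWave a * P.symbol := by
  ext α l
  rw [coeff_symbol, coeff_smul, MvPowerSeries.coeff_mul, MvPowerSeries.coeff_mul,
    HahnSeries.coeff_sum]
  refine Finset.sum_congr rfl fun p _ => ?_
  rw [coeff_timeToWave, HahnSeries.C_mul_eq_smul, HahnSeries.coeff_smul, coeff_symbol, smul_eq_mul]

/-- Only derivatives of `Q` separate composition from multiplication of symbols, and here they all
vanish. Dependence on `t₂, t₃, …` is harmless. -/
theorem symbol_mul {P Q : PsiDO} (hQ : ∀ k, dt (Q.coeff k) = 0) :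
    (P * Q).symbol = P.symbol * Q.symbol := by
  obtain ⟨a, ha⟩ := P.bdd
  obtain ⟨b, hb⟩ := Q.bdd
  ext α l
  rw [coeff_symbol, coeff_mul_of_dt_eq_zero hQ ha hb (lo := -l - b) le_rfl, map_sum,
    MvPowerSeries.coeff_mul, HahnSeries.coeff_sum]
  have h1 : ∀ p ∈ Finset.HasAntidiagonal.antidiagonal α,
      (MvPowerSeries.coeff p.1 P.symbol * MvPowerSeries.coeff p.2 Q.symbol).coeff l =
        ∑ i ∈ Finset.Icc (-l - b) a, MvPowerSeries.coeff p.1 (P.coeff i) *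
          MvPowerSeries.coeff p.2 (Q.coeff (-l - i)) := by
    intro p _
    rw [laurent_coeff_mul (A := -a) (B := l + b)]
    · refine Finset.sum_nbij' (fun i => -i) (fun i => -i) ?_ ?_ ?_ ?_ ?_
      · intro i hi; simp only [Finset.mem_Icc] at hi ⊢; omega
      · intro i hi; simp only [Finset.mem_Icc] at hi ⊢; omega
      · intro i _; simp
      · intro i _; simp
      · intro i _
        rw [coeff_symbol, coeff_symbol]
        congr 3
        ring
    · intro i hi
      rw [coeff_symbol, ha _ (by omega), map_zero]
    · intro i hi
      rw [coeff_symbol, hb _ (by omega), map_zero]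
  rw [Finset.sum_congr rfl h1, Finset.sum_comm]
  exact Finset.sum_congr rfl fun i _ => MvPowerSeries.coeff_mul _ _ _

theorem symbol_ofLaurent (b : LaurentSeries ℂ) : (ofLaurent b).symbol = MvPowerSeries.C b := by
  classical
  ext α l
  rw [coeff_symbol, coeff_ofLaurent, neg_neg, MvPowerSeries.coeff_C, MvPowerSeries.coeff_C]
  split_ifs <;> simp

theorem symbol_mul_ofLaurent (P : PsiDO) (b : LaurentSeries ℂ) :
    (P * ofLaurent b).symbol = P.symbol * MvPowerSeries.C b := by
  rw [symbol_mul (dt_coeff_ofLaurent b), symbol_ofLaurent]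

theorem symbol_D_mul (P : PsiDO) :
    (Dpow 1 * P).symbol = dw P.symbol + MvPowerSeries.C zVar * P.symbol := by
  ext α l
  rw [coeff_symbol, coeff_D_mul, map_add, map_add, coeff_dw, MvPowerSeries.coeff_C_mul,
    HahnSeries.coeff_add', Pi.add_apply, coeff_zVar_mul, coeff_symbol, HahnSeries.coeff_smul,
    coeff_symbol, dt, MvPowerSeries.coeff_pderiv, add_comm]
  congr 1
  · rw [nsmul_eq_mul, mul_comm]; push_cast; rfl
  · congr 2; ring

end PsiDO

/-! ### The exponential `exp(ξ(t, z))` and the wave functions of operators -/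

/-- The weight `∑ i αᵢ` of a monomial in the times. -/
def weight (α : ℕ+ →₀ ℕ) : ℕ := α.sum fun i e => (i : ℕ) * e

/-- `exp(ξ(t, z))`. -/
def expXi : WaveRing := fun α =>
  HahnSeries.single (-(weight α : ℤ)) (α.prod fun _ e => ((e.factorial : ℂ))⁻¹)

theorem coeff_expXi (α : ℕ+ →₀ ℕ) : MvPowerSeries.coeff α expXi =
    HahnSeries.single (-(weight α : ℤ)) (α.prod fun _ e => ((e.factorial : ℂ))⁻¹) := rfl

theorem weight_add_single (α : ℕ+ →₀ ℕ) (k : ℕ) :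
    weight (α + Finsupp.single 1 k) = weight α + k := by
  rw [weight, Finsupp.sum_add_index' (by simp) (by intros; ring), Finsupp.sum_single_index (by simp)]
  simp [weight]

theorem prod_inv_factorial_add_single (α : ℕ+ →₀ ℕ) :
    ((α 1 : ℂ) + 1) * ((α + Finsupp.single 1 1).prod fun _ e => ((e.factorial : ℂ))⁻¹) =
      α.prod fun _ e => ((e.factorial : ℂ))⁻¹ := by
  rw [← Finsupp.mul_prod_erase' (α + Finsupp.single 1 1) 1 _ (by simp),
    ← Finsupp.mul_prod_erase' α 1 _ (by simp), Finsupp.erase_add, Finsupp.erase_single, add_zero,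
    ← mul_assoc]
  congr 1
  rw [Finsupp.add_apply, Finsupp.single_eq_same, Nat.factorial_succ]
  have h1 : ((α 1 : ℂ) + 1) ≠ 0 := Nat.cast_add_one_ne_zero _
  push_cast
  rw [mul_inv, ← mul_assoc, mul_inv_cancel₀ h1, one_mul]

theorem dw_expXi : dw expXi = MvPowerSeries.C zVar * expXi := by
  ext1 α
  rw [coeff_dw, MvPowerSeries.coeff_C_mul, coeff_expXi, coeff_expXi, zVar,
    HahnSeries.single_mul_single, one_mul, ← prod_inv_factorial_add_single α, weight_add_single,
    nsmul_eq_mul, ← HahnSeries.single_zero_natCast, HahnSeries.single_mul_single]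
  push_cast
  congr 1
  ring_nf

namespace PsiDO

/-- The wave function `T exp(ξ(t, z))`. -/
def wave (T : PsiDO) : WaveRing := expXi * T.symbol

theorem coeff_wave (T : PsiDO) (α : ℕ+ →₀ ℕ) (l : ℤ) :
    (MvPowerSeries.coeff α T.wave).coeff (-l) = waveCoeff T α l := by
  rw [wave, MvPowerSeries.coeff_mul, HahnSeries.coeff_sum, waveCoeff]
  refine Finset.sum_congr rfl fun p _ => ?_
  rw [coeff_expXi, HahnSeries.coeff_single_mul, coeff_symbol]
  congr 3
  rw [weight]
  ring

theorem wave_add (P Q : PsiDO) : (P + Q).wave = P.wave + Q.wave := by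
  rw [wave, symbol_add, mul_add]; rfl

theorem wave_zero : (0 : PsiDO).wave = 0 := by
  rw [wave, symbol_zero, mul_zero]

theorem wave_sub (P Q : PsiDO) : (P - Q).wave = P.wave - Q.wave := by
  rw [eq_sub_iff_add_eq, ← wave_add, sub_add_cancel]

theorem wave_smul (a : TimeRing) (P : PsiDO) : (a • P).wave = timeToWave a * P.wave := by
  rw [wave, symbol_smul, wave]; ring

theorem wave_mul {P Q : PsiDO} (hQ : ∀ k, dt (Q.coeff k) = 0) :
    (P * Q).wave = Q.symbol * P.wave := by
  rw [wave, symbol_mul hQ, wave]; ring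

theorem wave_mul_ofLaurent (P : PsiDO) (b : LaurentSeries ℂ) :
    (P * ofLaurent b).wave = MvPowerSeries.C b * P.wave := by
  rw [wave, symbol_mul_ofLaurent, wave]; ring

/-- The product rule with `∂ exp(ξ) / ∂t₁ = z exp(ξ)`: composition with `D` is differentiation of
the wave function. -/
theorem wave_D_mul (P : PsiDO) : (Dpow 1 * P).wave = dw P.wave := by
  rw [wave, symbol_D_mul, wave, Derivation.leibniz, dw_expXi]
  simp only [smul_eq_mul]
  ring

/-- A differential operator as a combination of powers of `D`. -/
theorem eq_sum_Dpow {P : PsiDO} {N : ℕ} (hP : ∀ k : ℤ, k < 0 ∨ N ≤ k → P.coeff k = 0) :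
    P = ∑ i ∈ Finset.range N, P.coeff i • Dpow i := by
  ext1; funext k
  rw [coeff_sum]
  simp only [coeff_smul, coeff_Dpow]
  by_cases hk : k < 0 ∨ N ≤ k
  · rw [hP k hk, Finset.sum_eq_zero]
    intro i hi
    rw [if_neg (by have := Finset.mem_range.mp hi; omega), mul_zero]
  · rw [Finset.sum_eq_single k.toNat]
    · rw [if_pos (by omega), mul_one, Int.toNat_of_nonneg (by omega)]
    · intro i _ hi
      rw [if_neg (by omega), mul_zero]
    · intro h
      simp only [Finset.mem_range] at h
      omega

end PsiDO

open Polynomial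

/-! ## Degrees of Laurent series in `1 / z` -/

/-- `x` is a series in `1 / z` of degree exactly `N` in `z`. -/
def HasDeg (x : LaurentSeries ℂ) (N : ℤ) : Prop :=
  x.coeff (-N) ≠ 0 ∧ ∀ l < -N, x.coeff l = 0

theorem exists_hasDeg {x : LaurentSeries ℂ} (hx : x ≠ 0) : ∃ N, HasDeg x N :=
  ⟨-x.order, by simpa [neg_neg] using HahnSeries.coeff_order_eq_zero.not.mpr hx,
    fun l hl => HahnSeries.coeff_eq_zero_of_lt_order (by simpa using hl)⟩

theorem HasDeg.ne_zero {x : LaurentSeries ℂ} {N : ℤ} (h : HasDeg x N) : x ≠ 0 := by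
  rintro rfl
  exact h.1 rfl

theorem HasDeg.unique {x : LaurentSeries ℂ} {N M : ℤ} (h : HasDeg x N) (h' : HasDeg x M) :
    N = M := by
  by_contra hne
  rcases lt_or_gt_of_ne hne with h1 | h1
  · exact h'.1 (h.2 _ (by omega))
  · exact h.1 (h'.2 _ (by omega))

theorem coeff_mul_neg_add {x y : LaurentSeries ℂ} {N M : ℤ} (hx : ∀ l < -N, x.coeff l = 0)
    (hy : ∀ l < -M, y.coeff l = 0) :
    (x * y).coeff (-(N + M)) = x.coeff (-N) * y.coeff (-M) := by
  rw [laurent_coeff_mul (A := -N) (B := -N) hx (fun l hl => hy l (by omega)), Finset.Icc_self,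
    Finset.sum_singleton]
  congr 2
  ring

theorem coeff_mul_eq_zero_of_lt {x y : LaurentSeries ℂ} {N M : ℤ} (hx : ∀ l < -N, x.coeff l = 0)
    (hy : ∀ l < -M, y.coeff l = 0) {l : ℤ} (hl : l < -(N + M)) : (x * y).coeff l = 0 := by
  rw [laurent_coeff_mul (A := -N) (B := l + M) hx (fun l hl => hy l (by omega)),
    Finset.Icc_eq_empty (by omega), Finset.sum_empty]

theorem HasDeg.mul {x y : LaurentSeries ℂ} {N M : ℤ} (hx : HasDeg x N) (hy : HasDeg y M) :
    HasDeg (x * y) (N + M) := by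
  refine ⟨?_, fun l hl => coeff_mul_eq_zero_of_lt hx.2 hy.2 hl⟩
  rw [coeff_mul_neg_add hx.2 hy.2]
  exact mul_ne_zero hx.1 hy.1

theorem hasDeg_one : HasDeg 1 0 := by
  refine ⟨by simp, fun l hl => ?_⟩
  rw [HahnSeries.coeff_one, if_neg (by omega)]

theorem HasDeg.pow {x : LaurentSeries ℂ} {N : ℤ} (hx : HasDeg x N) (k : ℕ) :
    HasDeg (x ^ k) (k * N) := by
  induction k with
  | zero => simpa using hasDeg_one
  | succ k ih =>
    rw [pow_succ]
    convert ih.mul hx using 1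
    push_cast
    ring

/-- A nonzero term of the largest degree has nothing to cancel against. -/
theorem eq_zero_of_sum_eq_zero {ι : Type*} {s : Finset ι} {f : ι → LaurentSeries ℂ} {N : ι → ℤ}
    (hf : ∀ i ∈ s, f i ≠ 0 → HasDeg (f i) (N i))
    (hN : ∀ i ∈ s, ∀ j ∈ s, f i ≠ 0 → f j ≠ 0 → N i = N j → i = j)
    (h : ∑ i ∈ s, f i = 0) : ∀ i ∈ s, f i = 0 := by
  classical
  by_contra! hne
  obtain ⟨i, hi, hmax⟩ := Finset.exists_max_image (s.filter fun i => f i ≠ 0) N (by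
    obtain ⟨i, hi, h0⟩ := hne
    exact ⟨i, Finset.mem_filter.mpr ⟨hi, h0⟩⟩)
  rw [Finset.mem_filter] at hi
  apply (hf i hi.1 hi.2).1
  have h1 : (∑ j ∈ s, f j).coeff (-N i) = (f i).coeff (-N i) := by
    rw [HahnSeries.coeff_sum]
    refine Finset.sum_eq_single i (fun j hj hji => ?_) (fun h => absurd hi.1 h)
    by_cases h0 : f j = 0
    · rw [h0]; rfl
    · have h2 := hmax j (Finset.mem_filter.mpr ⟨hj, h0⟩)
      have h3 : N j ≠ N i := fun h => hji (hN j hj i hi.1 h0 hi.2 h)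
      exact (hf j hj h0).2 _ (by omega)
  rw [← h1, h]
  rfl

/-! ## Polynomials as Laurent series -/

/-- The substitution `p(z) ↦ p(zⁿ)`, with values in Laurent series in `1 / z`. -/
def polyPow (n : ℕ) : ℂ[X] →+* LaurentSeries ℂ :=
  eval₂RingHom HahnSeries.C (HahnSeries.single (-(n : ℤ)) 1)

theorem polyPow_C (n : ℕ) (c : ℂ) : polyPow n (C c) = HahnSeries.C c := by simp [polyPow]

theorem polyPow_X (n : ℕ) : polyPow n X = HahnSeries.single (-(n : ℤ)) 1 := by simp [polyPow]

theorem polyPow_eq_sum (n : ℕ) (p : ℂ[X]) {N : ℕ} (hN : p.natDegree < N) :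
    polyPow n p = ∑ k ∈ Finset.range N, p.coeff k • HahnSeries.single (-(n * k : ℤ)) (1 : ℂ) := by
  rw [polyPow, coe_eval₂RingHom, eval₂_eq_sum_range' _ hN]
  refine Finset.sum_congr rfl fun k _ => ?_
  rw [HahnSeries.C_mul_eq_smul, HahnSeries.single_pow, one_pow,
    show k • (-(n : ℤ)) = -(n * k : ℤ) by simp [mul_comm]]

theorem aeval_zVar (p : ℂ[X]) : aeval zVar p = polyPow 1 p := by
  have : (algebraMap ℂ (LaurentSeries ℂ)) = HahnSeries.C :=
    RingHom.ext fun c => HahnSeries.ofPowerSeries_C c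
  rw [polyPow, coe_eval₂RingHom, aeval_def, this]
  rfl

theorem coeff_polyPow (a : ℕ) (ha : a ≠ 0) (p : ℂ[X]) (k : ℕ) :
    (polyPow a p).coeff (-(a * k : ℤ)) =
      p.coeff k := by
  rw [polyPow_eq_sum a p (N := max (p.natDegree + 1) (k + 1)) (by omega), HahnSeries.coeff_sum,
    Finset.sum_eq_single k]
  · rw [HahnSeries.coeff_smul, HahnSeries.coeff_single_same,
      smul_eq_mul, mul_one]
  · intro j _ hj
    rw [HahnSeries.coeff_smul, HahnSeries.coeff_single_of_ne, smul_zero]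
    intro h
    apply hj
    have ha' : (a : ℤ) ≠ 0 := by exact_mod_cast ha
    have : (a : ℤ) * k = a * j := by linarith
    exact_mod_cast (mul_left_cancel₀ ha' this).symm
  · intro h
    simp at h

theorem coeff_polyPow_eq_zero (a : ℕ) (p : ℂ[X]) {l : ℤ}
    (hl : ∀ k : ℕ, l ≠ -(a * k : ℤ)) :
    (polyPow a p).coeff l = 0 := by
  rw [polyPow_eq_sum a p p.natDegree.lt_succ_self, HahnSeries.coeff_sum]
  refine Finset.sum_eq_zero fun j _ => ?_
  rw [HahnSeries.coeff_smul, HahnSeries.coeff_single_of_ne, smul_zero]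
  intro h
  exact hl j h

theorem hasDeg_polyPow (a : ℕ) (ha : a ≠ 0) {p : ℂ[X]} (hp : p ≠ 0) :
    HasDeg (polyPow a p)
      (a * p.natDegree) := by
  refine ⟨?_, fun l hl => ?_⟩
  · rw [coeff_polyPow a ha]
    simpa using hp
  · by_cases h : ∃ k : ℕ, l = -(a * k : ℤ)
    · obtain ⟨k, rfl⟩ := h
      rw [coeff_polyPow a ha]
      apply coeff_eq_zero_of_natDegree_lt
      have h2 : (a : ℤ) * p.natDegree < a * k := by linarith
      have h3 := lt_of_mul_lt_mul_left h2 (by positivity)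
      exact_mod_cast h3
    · exact coeff_polyPow_eq_zero a p (by simpa using h)

theorem coeff_polyPow_one (p : ℂ[X]) (k : ℕ) : (polyPow 1 p).coeff (-(k : ℤ)) = p.coeff k := by
  simpa using coeff_polyPow 1 one_ne_zero p k

theorem coeff_polyPow_one_of_pos (p : ℂ[X]) {l : ℤ} (hl : 0 < l) : (polyPow 1 p).coeff l = 0 :=
  coeff_polyPow_eq_zero 1 p (by intro k; push_cast; omega)

theorem polyPow_one_injective : Function.Injective (polyPow 1) :=
  fun p q h => by
    ext k
    rw [← coeff_polyPow_one, h, coeff_polyPow_one]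

theorem exists_polyPow_one_eq {y : LaurentSeries ℂ} (hy : ∀ l, 0 < l → y.coeff l = 0) :
    ∃ q : ℂ[X], polyPow 1 q = y := by
  obtain ⟨A, hA⟩ := laurent_exists_bound y
  refine ⟨∑ k ∈ Finset.range ((-A).toNat + 1), monomial k (y.coeff (-(k : ℤ))), ?_⟩
  ext l
  rcases lt_or_ge 0 l with hl | hl
  · rw [coeff_polyPow_one_of_pos _ hl, hy l hl]
  · obtain ⟨k, rfl⟩ : ∃ k : ℕ, l = -(k : ℤ) := ⟨(-l).toNat, by omega⟩
    rw [coeff_polyPow_one, finsetSum_coeff]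
    simp only [coeff_monomial]
    rw [Finset.sum_ite_eq']
    split_ifs with h
    · rfl
    · rw [hA]
      simp only [Finset.mem_range] at h
      omega

/-! ## The ring homomorphism `b ↦ b(Λ)` -/

/-- Division with remainder by `n` writes each `u` uniquely as `n * r - i + j`. This splits an
exponent of `b` into a matrix index `j` and a power `r`. -/
theorem sum_Icc_eq_sum_fin {n : ℕ} (f : ℤ → ℂ) (i a b : ℤ) :
    ∑ u ∈ Finset.Icc (n * a - i) (n * b + n - 1 - i), f u =
      ∑ j : Fin n, ∑ r ∈ Finset.Icc a b, f (n * r - i + (j : ℕ)) := by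
  rw [← Finset.sum_product']
  symm
  refine Finset.sum_bij (fun p _ => n * p.2 - i + (p.1 : ℕ)) ?_ ?_ ?_ ?_
  · rintro ⟨j, r⟩ h
    simp only [Finset.mem_product, Finset.mem_univ, true_and, Finset.mem_Icc] at h ⊢
    have hj : ((j : ℕ) : ℤ) < n := by exact_mod_cast j.isLt
    have h1 : (n : ℤ) * a ≤ n * r := mul_le_mul_of_nonneg_left h.1 (by positivity)
    have h2 : (n : ℤ) * r ≤ n * b := mul_le_mul_of_nonneg_left h.2 (by positivity)
    omega
  · rintro ⟨j, r⟩ _ ⟨j', r'⟩ _ h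
    simp only at h
    have hj : ((j : ℕ) : ℤ) < n := by exact_mod_cast j.isLt
    have hj' : ((j' : ℕ) : ℤ) < n := by exact_mod_cast j'.isLt
    have hr : r = r' := by
      by_contra hne
      rcases lt_or_gt_of_ne hne with h0 | h0 <;> nlinarith
    subst hr
    have : j = j' := Fin.ext (by omega)
    rw [this]
  · intro u hu
    rw [Finset.mem_Icc] at hu
    have hn : (0 : ℤ) < n := by
      rcases Nat.eq_zero_or_pos n with rfl | h
      · simp at hu; omega
      · exact_mod_cast h
    have h1 := Int.emod_nonneg (u + i) hn.ne'
    have h2 := Int.emod_lt_of_pos (u + i) hn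
    have h3 := Int.mul_ediv_add_emod (u + i) n
    refine ⟨(⟨((u + i) % n).toNat, by omega⟩, (u + i) / n), ?_, ?_⟩
    · simp only [Finset.mem_product, Finset.mem_univ, true_and, Finset.mem_Icc]
      constructor
      · rw [Int.le_ediv_iff_mul_le hn]; linarith
      · rw [← Int.lt_add_one_iff, Int.ediv_lt_iff_lt_mul hn]; linarith
    · simp only
      rw [Int.toNat_of_nonneg h1]
      linarith
  · rintro ⟨j, r⟩ _
    rfl

theorem exists_mul_bound {n : ℕ} (hn : 0 < n) (x : LaurentSeries ℂ) :
    ∃ a : ℤ, ∀ l < n * a, x.coeff l = 0 := by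
  obtain ⟨A, hA⟩ := laurent_exists_bound x
  exact ⟨A / n, fun l hl => hA l (hl.trans_le (Int.mul_ediv_self_le (by omega)))⟩

theorem evalLam_coeff_eq_zero {n : ℕ} {b : LaurentSeries ℂ} {a : ℤ}
    (h : ∀ l < n * a, b.coeff l = 0) (i j : Fin n) {r : ℤ} (hr : r < a) :
    (evalLam b i j).coeff r = 0 := by
  rw [evalLam_coeff]
  apply h
  have hj : ((j : ℕ) : ℤ) < n := by exact_mod_cast j.isLt
  have : (n : ℤ) * (r + 1) ≤ n * a := mul_le_mul_of_nonneg_left hr (by positivity)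
  rw [mul_add, mul_one] at this
  omega

theorem evalLam_mul {n : ℕ} (b c : LaurentSeries ℂ) :
    (evalLam (b * c) : Matrix (Fin n) (Fin n) _) = evalLam b * evalLam c := by
  ext i k q
  obtain ⟨a, ha⟩ := exists_mul_bound i.pos b
  obtain ⟨a', ha'⟩ := exists_mul_bound i.pos c
  have hk : ((k : ℕ) : ℤ) < n := by exact_mod_cast k.isLt
  rw [evalLam_coeff, Matrix.mul_apply, HahnSeries.coeff_sum,
    laurent_coeff_mul (A := n * a - (i : ℕ)) (B := n * (q - a') + n - 1 - (i : ℕ))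
      (fun l hl => ha l (by omega)) (fun l hl => ha' l (by linarith)), sum_Icc_eq_sum_fin]
  refine Finset.sum_congr rfl fun j _ => ?_
  rw [laurent_coeff_mul (A := a) (B := q - a')
    (fun l hl => evalLam_coeff_eq_zero ha i j hl)
    (fun l hl => evalLam_coeff_eq_zero ha' j k (by omega))]
  refine Finset.sum_congr rfl fun r _ => ?_
  rw [evalLam_coeff, evalLam_coeff]
  congr 2
  ring

theorem evalLam_add {n : ℕ} (b c : LaurentSeries ℂ) :
    (evalLam (b + c) : Matrix (Fin n) (Fin n) _) = evalLam b + evalLam c := by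
  ext i j q
  simp [evalLam_coeff]

/-- The ring homomorphism `b ↦ b(Λ)`. -/
def evalLamHom (n : ℕ) : LaurentSeries ℂ →+* Matrix (Fin n) (Fin n) (LaurentSeries ℂ) where
  toFun := evalLam
  map_one' := evalLam_one
  map_mul' := evalLam_mul
  map_zero' := by
    ext i j q
    simp [evalLam_coeff]
  map_add' := evalLam_add

theorem evalLamHom_apply {n : ℕ} (b : LaurentSeries ℂ) : evalLamHom n b = evalLam b := rfl

theorem exists_eq_mul_sub {n : ℕ} (hn : 0 < n) (l : ℤ) :
    ∃ (q : ℤ) (i : Fin n), l = n * q - (i : ℕ) := by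
  have hn' : (0 : ℤ) < n := by exact_mod_cast hn
  have h1 := Int.emod_nonneg (-l) hn'.ne'
  have h2 := Int.emod_lt_of_pos (-l) hn'
  have h3 := Int.mul_ediv_add_emod (-l) n
  refine ⟨-(-l / n), ⟨(-l % n).toNat, by omega⟩, ?_⟩
  simp only
  rw [Int.toNat_of_nonneg h1, mul_neg]
  linarith

/-- The inverse of `Ξ`: the series `x` is `∑ᵢ zⁱ fᵢ(zⁿ)` with `fᵢ = split n x i`. -/
def split (n : ℕ) (x : LaurentSeries ℂ) (i : Fin n) : LaurentSeries ℂ := evalLam x i ⟨0, i.pos⟩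

theorem split_coeff {n : ℕ} (x : LaurentSeries ℂ) (i : Fin n) (q : ℤ) :
    (split n x i).coeff q = x.coeff (n * q - (i : ℕ)) := by
  rw [split, evalLam_coeff]
  simp

theorem split_injective {n : ℕ} (hn : 0 < n) : Function.Injective (split n) := fun x y h => by
  ext l
  obtain ⟨q, i, rfl⟩ := exists_eq_mul_sub hn l
  rw [← split_coeff, h, split_coeff]

/-- `split n x` is the first column of `x(Λ)`, so this is the first column of `(b x)(Λ) = b(Λ)
x(Λ)`. -/
theorem split_mul {n : ℕ} (b x : LaurentSeries ℂ) :
    split n (b * x) = (evalLam b).mulVec (split n x) := by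
  ext1 i
  rw [split, evalLam_mul]
  rfl

theorem split_add {n : ℕ} (x y : LaurentSeries ℂ) : split n (x + y) = split n x + split n y := by
  ext i q
  simp [split_coeff]

theorem split_smul {n : ℕ} (c : ℂ) (x : LaurentSeries ℂ) : split n (c • x) =
    (HahnSeries.C c : LaurentSeries ℂ) • split n x := by
  ext i q
  rw [Pi.smul_apply, smul_eq_mul, HahnSeries.C_mul_eq_smul]
  simp [split_coeff]

theorem split_zero {n : ℕ} : split n 0 = 0 := by
  ext i q
  simp [split_coeff]

theorem split_surjective {n : ℕ} (hn : 0 < n) : Function.Surjective (split n) := fun v => by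
  have hn' : (0 : ℤ) < n := by exact_mod_cast hn
  have hlt : ∀ l : ℤ, (-l % n).toNat < n := fun l => by
    have h1 := Int.emod_nonneg (-l) hn'.ne'
    have h2 := Int.emod_lt_of_pos (-l) hn'
    omega
  obtain ⟨A, hA⟩ := (Set.finite_range fun i => (v i).order).bddBelow
  refine ⟨HahnSeries.ofSuppBddBelow
    (fun l => (v ⟨(-l % n).toNat, hlt l⟩).coeff (-(-l / n))) ⟨n * (A - 1), fun l hl => ?_⟩, ?_⟩
  · by_contra h
    refine hl (HahnSeries.coeff_eq_zero_of_lt_order (lt_of_lt_of_le ?_ (hA ⟨_, rfl⟩)))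
    have : 1 - A ≤ -l / n := by
      rw [Int.le_ediv_iff_mul_le hn']
      linarith
    omega
  · ext i q
    rw [split_coeff]
    change (v ⟨(-(n * q - (i : ℕ)) % n).toNat, _⟩).coeff (-(-(n * q - (i : ℕ)) / n)) = _
    have hi : ((i : ℕ) : ℤ) < n := by exact_mod_cast i.isLt
    have h1 : -((n : ℤ) * q - (i : ℕ)) = (i : ℕ) + n * (-q) := by ring
    have h2 : (-((n : ℤ) * q - (i : ℕ))) % n = (i : ℕ) := by
      rw [h1, Int.add_mul_emod_self_left, Int.emod_eq_of_lt (by positivity) hi]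
    have h3 : (-((n : ℤ) * q - (i : ℕ))) / n = -q := by
      rw [h1, Int.add_mul_ediv_left _ _ hn'.ne', Int.ediv_eq_zero_of_lt (by positivity) hi,
        zero_add]
    simp only [h2, h3, neg_neg, Int.toNat_natCast]

theorem evalLam_C {n : ℕ} (c : ℂ) : (evalLam (HahnSeries.C c) : Matrix (Fin n) (Fin n) _) =
    Matrix.scalar (Fin n) (HahnSeries.C c : LaurentSeries ℂ) := by
  have h1 : (HahnSeries.C c : LaurentSeries ℂ) = c • 1 := by
    rw [← HahnSeries.C_mul_eq_smul, mul_one]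
  have h2 : (evalLam (c • 1 : LaurentSeries ℂ) : Matrix (Fin n) (Fin n) _) = c • evalLam 1 := by
    ext i j q
    simp [evalLam_coeff]
  rw [h1, h2, evalLam_one]
  ext i j q
  simp [Matrix.one_apply, Matrix.diagonal_apply, smul_ite]

theorem evalLam_single {n : ℕ} : (evalLam (HahnSeries.single (-(n : ℤ)) 1) :
    Matrix (Fin n) (Fin n) _) = Matrix.scalar (Fin n) zVar := by
  have h : (HahnSeries.single (-(n : ℤ)) 1 : LaurentSeries ℂ) = zVar ^ n := by
    rw [zVar, HahnSeries.single_pow, one_pow]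
    simp
  ext i j q
  have hn : (0 : ℤ) < n := by exact_mod_cast i.pos
  have hi : ((i : ℕ) : ℤ) < n := by exact_mod_cast i.isLt
  have hj : ((j : ℕ) : ℤ) < n := by exact_mod_cast j.isLt
  rw [evalLam_coeff, Matrix.scalar_apply, Matrix.diagonal_apply, zVar]
  by_cases hij : i = j
  · subst hij
    rw [if_pos rfl, sub_add_cancel]
    by_cases hq : q = -1
    · subst hq; simp
    · rw [HahnSeries.coeff_single_of_ne hq, HahnSeries.coeff_single_of_ne]
      intro h1
      exact hq (mul_left_cancel₀ hn.ne' (by linarith))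
  · rw [if_neg hij, HahnSeries.coeff_zero, HahnSeries.coeff_single_of_ne]
    intro h1
    have hq : q = -1 := by
      by_contra hq
      rcases lt_or_gt_of_ne hq with h0 | h0 <;> nlinarith
    subst hq
    exact hij (Fin.ext (by omega))

theorem evalLam_polyPow {n : ℕ} (p : ℂ[X]) : (evalLam (polyPow n p) :
    Matrix (Fin n) (Fin n) _) = Matrix.scalar (Fin n) (polyPow 1 p) := by
  have : (evalLamHom n).comp (polyPow n) =
      (Matrix.scalar (Fin n)).comp (polyPow 1) := by
    apply Polynomial.ringHom_ext
    · intro c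
      simp only [RingHom.comp_apply, polyPow_C]
      exact evalLam_C c
    · simp only [RingHom.comp_apply, polyPow_X]
      exact evalLam_single
  exact congrArg (fun f => f p) this

theorem split_polyPow_mul {n : ℕ} (p : ℂ[X]) (x : LaurentSeries ℂ) :
    split n (polyPow n p * x) = polyPow 1 p • split n x := by
  rw [split_mul, evalLam_polyPow, Matrix.scalar_apply]
  ext1 i
  rw [Matrix.mulVec_diagonal]
  rfl

theorem exists_poly_split {n : ℕ} {x : LaurentSeries ℂ} (hx : ∀ l, 0 < l → x.coeff l = 0) :
    ∃ p : Fin n → ℂ[X], split n x = fun i => polyPow 1 (p i) := by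
  have h : ∀ i : Fin n, ∃ p : ℂ[X], polyPow 1 p = split n x i := fun i =>
    exists_polyPow_one_eq fun l hl => by
      rw [split_coeff]
      apply hx
      have hi : ((i : ℕ) : ℤ) < n := by exact_mod_cast i.isLt
      have : (n : ℤ) * 1 ≤ n * l := mul_le_mul_of_nonneg_left hl (by positivity)
      omega
  choose p hp using h
  exact ⟨p, funext fun i => (hp i).symm⟩

/-! ## Division with remainder by a family of series of all degrees -/

/-- Elimination from the top: the monic `w N` removes the power `z ^ N`, and only finitely many
nonnegative powers occur in `x`. -/
theorem exists_mem_span_sub {w : ℕ → LaurentSeries ℂ} (h1 : ∀ N : ℕ, (w N).coeff (-(N : ℤ)) = 1)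
    (h2 : ∀ (N : ℕ), ∀ l < -(N : ℤ), (w N).coeff l = 0) (x : LaurentSeries ℂ) :
    ∃ y ∈ Submodule.span ℂ (Set.range w), ∀ l ≤ 0, (x - y).coeff l = 0 := by
  have key : ∀ (N : ℕ) (x : LaurentSeries ℂ), (∀ l ≤ -(N : ℤ), x.coeff l = 0) →
      ∃ y ∈ Submodule.span ℂ (Set.range w), ∀ l ≤ 0, (x - y).coeff l = 0 := by
    intro N
    induction N with
    | zero => exact fun x hx => ⟨0, Submodule.zero_mem _, by simpa using hx⟩
    | succ N ih =>
      intro x hx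
      obtain ⟨y, hy, hxy⟩ := ih (x - x.coeff (-(N : ℤ)) • w N) fun l hl => by
        rw [HahnSeries.coeff_sub, HahnSeries.coeff_smul]
        rcases eq_or_lt_of_le hl with rfl | hl
        · rw [h1, smul_eq_mul, mul_one, sub_self]
        · rw [h2 N l hl, smul_zero, sub_zero, hx l (by push_cast; omega)]
      refine ⟨y + x.coeff (-(N : ℤ)) • w N, Submodule.add_mem _ hy
        (Submodule.smul_mem _ _ (Submodule.subset_span ⟨N, rfl⟩)), fun l hl => ?_⟩
      rw [← hxy l hl, sub_sub, add_comm y]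
  obtain ⟨A, hA⟩ := laurent_exists_bound x
  exact key (-A + 1).toNat x fun l hl => hA l (by omega)

/-! ## Matrices which are upper unitriangular at `z = ∞` -/

/-- An upper unitriangular constant matrix plus `O(1 / z)`. -/
structure IsUnipotentAtInfty {n : ℕ} (Γ : Matrix (Fin n) (Fin n) (LaurentSeries ℂ)) : Prop where
  neg : ∀ i j, ∀ r < 0, (Γ i j).coeff r = 0
  diag : ∀ i, (Γ i i).coeff 0 = 1
  lower : ∀ i j, j < i → (Γ i j).coeff 0 = 0

namespace IsUnipotentAtInfty

variable {n : ℕ} {Γ : Matrix (Fin n) (Fin n) (LaurentSeries ℂ)}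

/-- The matrix unit `E_{ij}` times `z ^ (-r)` changes the degree under `Ξ` by `i - j - n r`. This is
negative for `r ≥ 1`, and for `r = 0` above the diagonal; only the diagonal ones contribute at the
top. -/
theorem coeff_top (hΓ : IsUnipotentAtInfty Γ) {x y : LaurentSeries ℂ}
    (h : split n x = Γ.mulVec (split n y)) {N : ℤ} (hn : 0 < n)
    (hy : ∀ l < N, y.coeff l = 0) {l : ℤ} (hl : l ≤ N) : x.coeff l = y.coeff l := by
  obtain ⟨q, i, rfl⟩ := exists_eq_mul_sub hn l
  have hi : ((i : ℕ) : ℤ) < n := by exact_mod_cast i.isLt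
  have hn' : (0 : ℤ) < n := by exact_mod_cast hn
  obtain ⟨A, hA⟩ := (Set.finite_range fun j => (split n y j).order).bddBelow
  rw [← split_coeff, h, Matrix.mulVec, dotProduct, HahnSeries.coeff_sum]
  have h1 : ∀ j, (Γ i j * split n y j).coeff q =
      ∑ r ∈ Finset.Icc 0 (max 0 (q - A)), (Γ i j).coeff r * y.coeff (n * (q - r) - (j : ℕ)) := by
    intro j
    rw [laurent_coeff_mul (A := 0) (B := max 0 (q - A)) (hΓ.neg i j)]
    · simp only [split_coeff]
    · intro l hl
      refine HahnSeries.coeff_eq_zero_of_lt_order (lt_of_lt_of_le ?_ (hA ⟨j, rfl⟩))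
      omega
  have h2 : ∀ j, ∀ r ∈ Finset.Icc 0 (max 0 (q - A)), r ≠ 0 →
      (Γ i j).coeff r * y.coeff (n * (q - r) - (j : ℕ)) = 0 := by
    intro j r hr hr0
    rw [hy, mul_zero]
    have hr1 : 1 ≤ r := by have := (Finset.mem_Icc.mp hr).1; omega
    have : (n : ℤ) * 1 ≤ n * r := mul_le_mul_of_nonneg_left hr1 hn'.le
    rw [mul_sub]
    omega
  have h3 : ∀ j, (Γ i j * split n y j).coeff q = (Γ i j).coeff 0 * y.coeff (n * q - (j : ℕ)) := by
    intro j
    rw [h1, Finset.sum_eq_single 0 (h2 j) (by simp), sub_zero]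
  simp only [h3]
  rw [Finset.sum_eq_single i]
  · rw [hΓ.diag, one_mul]
  · intro j _ hj
    rcases lt_or_gt_of_ne hj with h4 | h4
    · rw [hΓ.lower i j h4, zero_mul]
    · rw [hy, mul_zero]
      have : (i : ℕ) < j := h4
      omega
  · simp

theorem hasDeg (hΓ : IsUnipotentAtInfty Γ) {x y : LaurentSeries ℂ}
    (h : split n x = Γ.mulVec (split n y)) {N : ℤ} (hn : 0 < n) (hy : HasDeg y N) :
    HasDeg x N :=
  ⟨by rw [hΓ.coeff_top h hn hy.2 le_rfl]; exact hy.1,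
    fun l hl => by rw [hΓ.coeff_top h hn hy.2 hl.le]; exact hy.2 l hl⟩

theorem eq_zero_of_mulVec_eq_zero (hΓ : IsUnipotentAtInfty Γ) (hn : 0 < n)
    {v : Fin n → LaurentSeries ℂ} (h : Γ.mulVec v = 0) : v = 0 := by
  obtain ⟨y, rfl⟩ := split_surjective hn v
  by_contra hv
  have hy : y ≠ 0 := by rintro rfl; exact hv split_zero
  obtain ⟨N, hN⟩ := exists_hasDeg hy
  exact (hΓ.hasDeg (x := 0) (by rw [h, split_zero]) hn hN).ne_zero rfl

theorem isUnit_det (hΓ : IsUnipotentAtInfty Γ) (hn : 0 < n) : IsUnit Γ.det := by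
  rw [isUnit_iff_ne_zero]
  intro h
  obtain ⟨v, hv, hv'⟩ := Matrix.exists_mulVec_eq_zero_iff.mpr h
  exact hv (hΓ.eq_zero_of_mulVec_eq_zero hn hv')

end IsUnipotentAtInfty

/-! ## The space `Γ ℂ[z]ⁿ` -/

/-- The image in `ℂ((1/z))` of `Γ ℂ[z]ⁿ` under `Ξ`. -/
def polySpace {n : ℕ} (Γ : Matrix (Fin n) (Fin n) (LaurentSeries ℂ)) :
    Submodule ℂ (LaurentSeries ℂ) where
  carrier := {x | ∃ p : Fin n → ℂ[X], split n x = Γ.mulVec fun j => polyPow 1 (p j)}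
  zero_mem' := ⟨0, by
    have : (fun j : Fin n => polyPow 1 ((0 : Fin n → ℂ[X]) j)) = 0 := by ext1 j; simp
    rw [this, Matrix.mulVec_zero, split_zero]⟩
  add_mem' := by
    rintro x y ⟨p, hp⟩ ⟨q, hq⟩
    refine ⟨p + q, ?_⟩
    have : (fun j : Fin n => polyPow 1 ((p + q) j)) =
      (fun j => polyPow 1 (p j)) + fun j => polyPow 1 (q j) := by ext1 j; simp
    rw [this, Matrix.mulVec_add, split_add, hp, hq]
  smul_mem' := by
    rintro c x ⟨p, hp⟩
    refine ⟨C c • p, ?_⟩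
    have : (fun j : Fin n => polyPow 1 ((C c • p) j)) =
        (HahnSeries.C c : LaurentSeries ℂ) • fun j => polyPow 1 (p j) := by
      ext1 j; rw [Pi.smul_apply, smul_eq_mul, map_mul, polyPow_C]; rfl
    rw [this, Matrix.mulVec_smul, split_smul, hp]

theorem polyPow_mul_mem {n : ℕ} {Γ : Matrix (Fin n) (Fin n) (LaurentSeries ℂ)} (q : ℂ[X])
    {x : LaurentSeries ℂ} (hx : x ∈ polySpace Γ) : polyPow n q * x ∈ polySpace Γ := by
  obtain ⟨p, hp⟩ := hx
  refine ⟨q • p, ?_⟩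
  have : (fun j : Fin n => polyPow 1 ((q • p) j)) = polyPow 1 q • fun j => polyPow 1 (p j) := by
    ext1 j; simp
  rw [this, Matrix.mulVec_smul, split_polyPow_mul, hp]

namespace IsUnipotentAtInfty

variable {n : ℕ} {Γ : Matrix (Fin n) (Fin n) (LaurentSeries ℂ)}

/-- The images under `Γ` of the powers `z ^ N`, `N ≥ 0`, are monic of degree `N`, so division with
remainder applies. -/
theorem exists_mem_polySpace_sub (hΓ : IsUnipotentAtInfty Γ) (hn : 0 < n) (x : LaurentSeries ℂ) :
    ∃ y ∈ polySpace Γ, ∀ l ≤ 0, (x - y).coeff l = 0 := by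
  have h : ∀ N : ℕ, ∃ w ∈ polySpace Γ, w.coeff (-(N : ℤ)) = 1 ∧
      ∀ l < -(N : ℤ), w.coeff l = 0 := by
    intro N
    obtain ⟨w, hw⟩ := split_surjective hn
      (Γ.mulVec (split n (HahnSeries.single (-(N : ℤ)) (1 : ℂ))))
    have h0 : ∀ l < -(N : ℤ), (HahnSeries.single (-(N : ℤ)) (1 : ℂ)).coeff l = 0 := fun l hl =>
      HahnSeries.coeff_single_of_ne (by omega)
    obtain ⟨p, hp⟩ := exists_poly_split (n := n) (x := HahnSeries.single (-(N : ℤ)) (1 : ℂ))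
      fun l hl => HahnSeries.coeff_single_of_ne (by omega)
    refine ⟨w, ⟨p, by rw [hw, hp]⟩, ?_, fun l hl => ?_⟩
    · rw [hΓ.coeff_top hw hn h0 le_rfl, HahnSeries.coeff_single_same]
    · rw [hΓ.coeff_top hw hn h0 hl.le, h0 l hl]
  choose w hw h1 h2 using h
  obtain ⟨y, hy, hxy⟩ := exists_mem_span_sub h1 h2 x
  refine ⟨y, Submodule.span_le.mpr ?_ hy, hxy⟩
  rintro _ ⟨N, rfl⟩
  exact hw N

/-- A nonzero polynomial vector has degree at least `0` under `Ξ`, and `Γ` preserves the degree. -/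
theorem eq_zero_of_mem_polySpace (hΓ : IsUnipotentAtInfty Γ) (hn : 0 < n) {x : LaurentSeries ℂ}
    (hx : x ∈ polySpace Γ) (h : ∀ l ≤ 0, x.coeff l = 0) : x = 0 := by
  obtain ⟨p, hp⟩ := hx
  obtain ⟨y, hy⟩ := split_surjective hn fun j => polyPow 1 (p j)
  rw [← hy] at hp
  by_cases hy0 : y = 0
  · apply split_injective hn
    rw [hp, hy0, split_zero, Matrix.mulVec_zero]
  · exfalso
    obtain ⟨N, hN⟩ := exists_hasDeg hy0
    have hx := hΓ.hasDeg hp hn hN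
    have h1 : 0 < -N := by
      by_contra h1
      exact hx.1 (h _ (by omega))
    obtain ⟨q, i, hq⟩ := exists_eq_mul_sub hn (-N)
    apply hN.1
    rw [hq, ← split_coeff, hy]
    apply coeff_polyPow_one_of_pos
    by_contra h2
    have : (n : ℤ) * q ≤ 0 := mul_nonpos_of_nonneg_of_nonpos (by positivity) (by omega)
    omega

end IsUnipotentAtInfty

/-! ## Elements of `W` with polynomial preimage -/

/-- A polynomial as a function on the unit circle. -/
def trig (p : ℂ[X]) : C(UnitAddCircle, ℂ) :=
  ∑ l ∈ Finset.range (p.natDegree + 1), p.coeff l • fourier (l : ℤ)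

theorem trig_bounded (p : ℂ[X]) : ∀ t, ‖trig p t‖ ≤ ‖trig p‖ := (trig p).norm_coe_le_norm

theorem integrable_mul_trig {g : UnitAddCircle → ℂ} (hg : Integrable g haarAddCircle) (p : ℂ[X]) :
    Integrable (fun t => g t * trig p t) haarAddCircle :=
  hg.mul_bdd (trig p).continuous.aestronglyMeasurable (ae_of_all _ (trig_bounded p))

theorem fourierCoeff_mul_trig {g : UnitAddCircle → ℂ} (hg : Integrable g haarAddCircle) (p : ℂ[X])
    (k : ℤ) : fourierCoeff (fun t => g t * trig p t) k =
      ∑ l ∈ Finset.range (p.natDegree + 1), p.coeff l * fourierCoeff g (k - l) := by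
  have h1 : ∀ t, fourier (-k) t • (g t * trig p t) =
      ∑ l ∈ Finset.range (p.natDegree + 1),
        p.coeff l * (fourier (-(k - (l : ℤ))) t • g t) := by
    intro t
    simp only [trig, ContinuousMap.coe_sum, ContinuousMap.coe_smul, Finset.sum_apply,
      Pi.smul_apply, smul_eq_mul, Finset.mul_sum]
    refine Finset.sum_congr rfl fun l _ => ?_
    rw [show -(k - (l : ℤ)) = -k + l by ring, fourier_add]
    ring
  rw [fourierCoeff]
  simp only [h1]
  rw [integral_finsetSum _ fun l _ => (hg.fourier_smul _).const_mul _]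
  refine Finset.sum_congr rfl fun l _ => ?_
  rw [integral_const_mul]
  rfl

theorem fourierCoeff_one_fun (k : ℤ) :
    fourierCoeff (fun _ : UnitAddCircle => (1 : ℂ)) k = if k = 0 then 1 else 0 := by
  have h := congrFun (fourierCoeff_fourier (T := (1 : ℝ)) 0) k
  have h1 : (⇑(fourier 0 : C(UnitAddCircle, ℂ))) = fun _ => (1 : ℂ) := by
    ext t; exact fourier_zero
  rw [h1] at h
  rw [h, Pi.single_apply]

theorem fourierCoeff_trig (p : ℂ[X]) (k : ℤ) :
    fourierCoeff (trig p) k = (polyPow 1 p).coeff (-k) := by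
  have h := fourierCoeff_mul_trig (g := fun _ => (1 : ℂ)) (integrable_const _) p k
  simp only [one_mul] at h
  rw [h, polyPow_eq_sum 1 p p.natDegree.lt_succ_self, HahnSeries.coeff_sum]
  refine Finset.sum_congr rfl fun l _ => ?_
  rw [fourierCoeff_one_fun, HahnSeries.coeff_smul, HahnSeries.coeff_single, smul_eq_mul]
  have h1 : -k = -(((1 : ℕ) : ℤ) * l) ↔ k - (l : ℤ) = 0 := by push_cast; omega
  by_cases h2 : k - (l : ℤ) = 0
  · rw [if_pos h2, if_pos (h1.mpr h2)]
  · rw [if_neg h2, if_neg (h1.not.mpr h2)]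

theorem exists_Hn_of_memLp {n : ℕ} {F : UnitAddCircle → Fin n → ℂ}
    (hF : ∀ i, MemLp (fun t => F t i) 2 haarAddCircle) :
    ∃ f : Hn n, (∀ᵐ t ∂haarAddCircle, ∀ i, f t i = F t i) ∧
      ∀ i k, vecCoeff f i k = fourierCoeff (fun t => F t i) k := by
  have h : MemLp (fun t => (WithLp.toLp 2 (F t) : EuclideanSpace ℂ (Fin n))) 2
      (haarAddCircle : Measure UnitAddCircle) := memLp_piLp_iff.mpr hF
  have hae : ∀ᵐ t ∂haarAddCircle, ∀ i, h.toLp _ t i = F t i := by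
    filter_upwards [h.coeFn_toLp] with t ht i
    rw [ht]
  refine ⟨h.toLp _, hae, fun i k => ?_⟩
  rw [vecCoeff, fourierCoeff_congr_ae (g := fun t => F t i)]
  filter_upwards [hae] with t ht
  exact ht i

theorem exists_HPlus (n : ℕ) (p : Fin n → ℂ[X]) : ∃ f ∈ HPlus n,
    (∀ᵐ t ∂haarAddCircle, ∀ i, f t i = trig (p i) t) ∧
      ∀ i k, vecCoeff f i k = (polyPow 1 (p i)).coeff (-k) := by
  obtain ⟨f, hf, hf'⟩ := exists_Hn_of_memLp (F := fun t i => trig (p i) t) fun i =>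
    MemLp.of_bound (trig (p i)).continuous.aestronglyMeasurable _ (ae_of_all _ (trig_bounded (p i)))
  have hc : ∀ i k, vecCoeff f i k = (polyPow 1 (p i)).coeff (-k) := fun i k => by
    rw [hf']
    exact fourierCoeff_trig (p i) k
  refine ⟨f, fun i k hk => ?_, hf, hc⟩
  rw [hc, coeff_polyPow_one_of_pos _ (by omega)]

theorem loopSeries_coeff {n : ℕ} {γ : MatLoop n} (hnorm : IsNormalized γ) (i j : Fin n) (r : ℤ) :
    (loopSeries γ i j).coeff r = loopCoeff γ (-r) i j := by
  rw [loopSeries, Matrix.of_apply, PowerSeries.coeff_coe]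
  split_ifs with h
  · rw [hnorm.pos _ (by omega)]
    rfl
  · rw [PowerSeries.coeff_mk]
    congr 2
    omega

theorem IsNormalized.isUnipotentAtInfty {n : ℕ} {γ : MatLoop n} (hnorm : IsNormalized γ) :
    IsUnipotentAtInfty (loopSeries γ) where
  neg i j r hr := by
    rw [loopSeries_coeff hnorm, hnorm.pos _ (by omega)]
    rfl
  diag i := by rw [loopSeries_coeff hnorm, neg_zero, hnorm.diag]
  lower i j h := by rw [loopSeries_coeff hnorm, neg_zero, hnorm.lower i j h]

theorem IsHalfLoop.integrable {n : ℕ} {γ : MatLoop n} (hγ : IsHalfLoop γ) (i j : Fin n) :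
    Integrable (fun t => γ t i j) haarAddCircle := by
  obtain ⟨K, hK⟩ := hγ.bdd
  exact Integrable.of_bound (hγ.meas i j) K (by filter_upwards [hK] with t ht using ht i j)

/-- For a polynomial factor the convolution of Fourier coefficients is a finite sum, so it agrees
with the formal product of Laurent series. -/
theorem exists_mem_loopSpace {n : ℕ} {γ : MatLoop n} (hγ : IsHalfLoop γ)
    (hnorm : IsNormalized γ) (p : Fin n → ℂ[X]) : ∃ f ∈ loopSpace γ, ∀ i k,
      vecCoeff f i k = ((loopSeries γ).mulVec (fun j => polyPow 1 (p j)) i).coeff (-k) := by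
  obtain ⟨h, hh, hht, -⟩ := exists_HPlus n p
  obtain ⟨K, hK⟩ := hγ.bdd
  have hint : ∀ i j, Integrable (fun t => γ t i j * trig (p j) t) haarAddCircle := fun i j =>
    integrable_mul_trig (hγ.integrable i j) (p j)
  obtain ⟨f, hf, hf'⟩ := exists_Hn_of_memLp
    (F := fun t i => ∑ j, γ t i j * trig (p j) t) fun i => by
      refine memLp_finsetSum _ fun j _ => ?_
      refine MemLp.of_bound (hint i j).aestronglyMeasurable (K * ‖trig (p j)‖) ?_
      filter_upwards [hK] with t ht
      rw [norm_mul]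
      exact mul_le_mul (ht i j) (trig_bounded _ t) (norm_nonneg _) ((norm_nonneg _).trans (ht i j))
  refine ⟨f, ⟨h, hh, ?_⟩, fun i k => ?_⟩
  · filter_upwards [hf, hht] with t h1 h2
    ext1 i
    rw [h1, Matrix.mulVec, dotProduct]
    simp only [h2]
  · rw [hf', Matrix.mulVec, dotProduct, HahnSeries.coeff_sum]
    have h1 : (fun t => ∑ j, γ t i j * trig (p j) t) = ∑ j, fun t => γ t i j * trig (p j) t := by
      ext t; simp
    rw [h1, fourierCoeff.sum _ _ fun j _ => hint i j, Finset.sum_apply]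
    refine Finset.sum_congr rfl fun j _ => ?_
    rw [fourierCoeff_mul_trig (hγ.integrable i j), polyPow_eq_sum 1 _ (Nat.lt_succ_self _),
      Finset.mul_sum, HahnSeries.coeff_sum]
    refine Finset.sum_congr rfl fun l _ => ?_
    rw [← HahnSeries.C_mul_eq_smul, mul_left_comm, HahnSeries.C_mul_eq_smul,
      HahnSeries.coeff_smul, HahnSeries.coeff_mul_single, mul_one,
      loopSeries_coeff hnorm, smul_eq_mul, loopCoeff, Matrix.of_apply]
    congr 2
    push_cast
    ring

/-- In the big cell, the elements of finite order of `W` are those of `Γ ℂ[z]ⁿ`. -/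
theorem mem_polySpace_of_isFourierOfMem {n : ℕ} (hn : 0 < n) {γ : MatLoop n} (hγ : IsHalfLoop γ)
    (hnorm : IsNormalized γ) (hcell : InBigCell (loopSpace γ)) {x : LaurentSeries ℂ}
    (hx : IsFourierOfMem (loopSpace γ) fun l => x.coeff (-l)) :
    x ∈ polySpace (loopSeries γ) := by
  obtain ⟨f, hf, hfx⟩ := hx
  obtain ⟨y, hy, hxy⟩ := hnorm.isUnipotentAtInfty.exists_mem_polySpace_sub hn x
  obtain ⟨p, hp⟩ := id hy
  obtain ⟨f', hf', hfy⟩ := exists_mem_loopSpace hγ hnorm p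
  have hsplit : ∀ (u : LaurentSeries ℂ) (i : Fin n) (k : ℤ),
      u.coeff (-(n * k + (i : ℕ))) = (split n u i).coeff (-k) := fun u i k => by
    rw [split_coeff]
    congr 1
    ring
  have hfy' : ∀ i k, vecCoeff f' i k = y.coeff (-(n * k + (i : ℕ))) := fun i k => by
    rw [hfy, ← hp, hsplit]
  have hle : ∀ (i : Fin n) (k : ℤ), 0 ≤ k → -((n : ℤ) * k + (i : ℕ)) ≤ 0 := fun i k hk => by
    have : 0 ≤ (n : ℤ) * k := by positivity
    omega
  -- Only finitely many nonnegative modes of `x` are nonzero, so they form a polynomial vector, and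
  -- its function `g` lies in `HPlus n`.
  have hg : ∀ i : Fin n, ∃ q : ℂ[X], ∀ k : ℕ, q.coeff k = (split n x i).coeff (-(k : ℤ)) := by
    intro i
    obtain ⟨q, hq⟩ := exists_polyPow_one_eq (y := HahnSeries.ofSuppBddBelow
      (fun l => if l ≤ 0 then (split n x i).coeff l else 0) (by
        obtain ⟨A, hA⟩ := laurent_exists_bound (split n x i)
        refine ⟨A, fun l hl => ?_⟩
        by_contra h
        exact hl (by simp [hA l (by omega)]))) fun l hl => if_neg (by omega)
    refine ⟨q, fun k => ?_⟩
    rw [← coeff_polyPow_one, hq]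
    exact if_pos (by omega)
  choose q hq using hg
  obtain ⟨g, hgH, -, hgc⟩ := exists_HPlus n q
  have hgx : ∀ (i : Fin n) (k : ℤ), 0 ≤ k → vecCoeff g i k = x.coeff (-(n * k + (i : ℕ))) := by
    intro i k hk
    lift k to ℕ using hk
    rw [hgc, coeff_polyPow_one, hq, hsplit]
  -- Both functions lie in `W` and project to `g`.
  have heq := (hcell g hgH).unique
    ⟨hf, fun i k hk => by rw [hfx, hgx i k hk]⟩
    ⟨hf', fun i k hk => by
      rw [hfy', hgx i k hk, eq_comm, ← sub_eq_zero, ← HahnSeries.coeff_sub]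
      exact hxy _ (hle i k hk)⟩
  convert hy
  apply split_injective hn
  ext i l
  have h := hfx i (-l)
  rw [heq, hfy'] at h
  rw [← neg_neg l, ← hsplit, ← hsplit, h]

/-! ## Wave functions with values in a subspace -/

/-- All coefficients of `F` (in the times) lie in `V`. -/
def ValuesIn (V : Submodule ℂ (LaurentSeries ℂ)) (F : WaveRing) : Prop :=
  ∀ α, MvPowerSeries.coeff α F ∈ V

namespace ValuesIn

variable {V : Submodule ℂ (LaurentSeries ℂ)} {F G : WaveRing}

theorem zero : ValuesIn V 0 := fun α => by
  rw [map_zero]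
  exact V.zero_mem

theorem add (hF : ValuesIn V F) (hG : ValuesIn V G) : ValuesIn V (F + G) := fun α => by
  rw [map_add]
  exact V.add_mem (hF α) (hG α)

theorem sub (hF : ValuesIn V F) (hG : ValuesIn V G) : ValuesIn V (F - G) := fun α => by
  rw [map_sub]
  exact V.sub_mem (hF α) (hG α)

/-- Each coefficient of the product is a finite `ℂ`-combination of coefficients of `F`, so a
function of the times acts although `V` is only `ℂ`-linear. -/
theorem timeToWave_mul (hF : ValuesIn V F) (a : TimeRing) : ValuesIn V (timeToWave a * F) :=
  fun α => by
    rw [MvPowerSeries.coeff_mul]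
    refine V.sum_mem fun p _ => ?_
    rw [coeff_timeToWave, HahnSeries.C_mul_eq_smul]
    exact V.smul_mem _ (hF _)

theorem dw (hF : ValuesIn V F) : ValuesIn V (dw F) := fun α => by
  rw [coeff_dw]
  exact V.nsmul_mem (hF _) _

theorem C_mul (hF : ValuesIn V F) {b : LaurentSeries ℂ} (hb : ∀ x ∈ V, b * x ∈ V) :
    ValuesIn V (MvPowerSeries.C b * F) := fun α => by
  rw [MvPowerSeries.coeff_C_mul]
  exact hb _ (hF α)

/-- Differential operators preserve wave functions with values in `V`. -/
theorem mul_wave {S M : PsiDO} {N : ℕ} (hS : ValuesIn V S.wave)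
    (hM : ∀ k : ℤ, k < 0 ∨ N ≤ k → M.coeff k = 0) : ValuesIn V (M * S).wave := by
  have hD : ∀ i : ℕ, ValuesIn V (PsiDO.Dpow i * S).wave := by
    intro i
    induction i with
    | zero => simpa [← PsiDO.one_eq_Dpow] using hS
    | succ i ih =>
      rw [Nat.cast_succ, ← PsiDO.D_mul_Dpow_mul, PsiDO.wave_D_mul]
      exact ih.dw
  rw [PsiDO.eq_sum_Dpow hM, Finset.sum_mul]
  induction Finset.range N using Finset.induction_on with
  | empty => simpa [PsiDO.wave_zero] using ValuesIn.zero
  | insert i s hi ih =>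
    rw [Finset.sum_insert hi, PsiDO.wave_add, PsiDO.smul_mul, PsiDO.wave_smul]
    exact ((hD i).timeToWave_mul _).add ih

end ValuesIn

/-! ### Leading terms of the coefficients of `t₁ ^ k` -/

theorem weight_add (α β : ℕ+ →₀ ℕ) : weight (α + β) = weight α + weight β :=
  Finsupp.sum_add_index' (by simp) (by intros; ring)

theorem weight_eq_zero {α : ℕ+ →₀ ℕ} (h : weight α = 0) : α = 0 := by
  ext i
  by_contra hi
  rw [weight, Finsupp.sum, Finset.sum_eq_zero_iff] at h
  have := h i (Finsupp.mem_support_iff.mpr hi)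
  rcases Nat.mul_eq_zero.mp this with h1 | h1
  · exact i.pos.ne' h1
  · exact hi h1

theorem waveCoeff_single_of_lt {S : PsiDO} (hS : S.IsMonicOfOrderZero) (k : ℕ) {l : ℤ}
    (hl : k < l) : waveCoeff S (Finsupp.single 1 k) l = 0 := by
  refine Finset.sum_eq_zero fun p hp => ?_
  have h1 := congrArg weight (Finset.HasAntidiagonal.mem_antidiagonal.mp hp)
  rw [weight_add, ← zero_add (Finsupp.single 1 k), weight_add_single] at h1
  have h2 : weight 0 = 0 := rfl
  rw [hS.2 _ (by change 0 < l - (weight p.1 : ℤ); omega), map_zero, mul_zero]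

/-- The power `z ^ k` needs weight `k` from `exp(ξ)`, because `S` has no positive orders; this
leaves only the term `t₁ ^ k z ^ k / k!`. -/
theorem waveCoeff_single_self {S : PsiDO} (hS : S.IsMonicOfOrderZero) (k : ℕ) :
    waveCoeff S (Finsupp.single 1 k) k = ((k.factorial : ℂ))⁻¹ := by
  have hk : weight (Finsupp.single 1 k) = k := by
    have := weight_add_single 0 k
    rwa [zero_add, show weight 0 = 0 from rfl, zero_add] at this
  rw [waveCoeff, Finset.sum_eq_single (Finsupp.single 1 k, 0)]
  · have h1 : (k : ℤ) - (((Finsupp.single (1 : ℕ+) k).sum fun i e => (i : ℕ) * e : ℕ) : ℤ) = 0 := by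
      change (k : ℤ) - (weight (Finsupp.single 1 k) : ℤ) = 0
      omega
    simp only [h1, hS.1]
    rw [Finsupp.prod_single_index (by simp)]
    simp
  · intro p hp hne
    have h1 := congrArg weight (Finset.HasAntidiagonal.mem_antidiagonal.mp hp)
    rw [weight_add, hk] at h1
    have h2 : weight p.2 ≠ 0 := fun h => hne (by
      have h3 := weight_eq_zero h
      have h4 := Finset.HasAntidiagonal.mem_antidiagonal.mp hp
      rw [h3, add_zero] at h4
      exact Prod.ext h4 h3)
    rw [hS.2 _ (by change 0 < (k : ℤ) - (weight p.1 : ℤ); omega), map_zero, mul_zero]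
  · intro h
    exact absurd (Finset.HasAntidiagonal.mem_antidiagonal.mpr (add_zero _)) h

/-! ### Multipliers of `Γ ℂ[z]ⁿ` -/

/-- Multiplication by `b` preserves `V`. -/
def Stabilizes (V : Submodule ℂ (LaurentSeries ℂ)) (b : LaurentSeries ℂ) : Prop :=
  ∀ x ∈ V, b * x ∈ V

theorem Stabilizes.sub {V : Submodule ℂ (LaurentSeries ℂ)} {b c : LaurentSeries ℂ}
    (hb : Stabilizes V b) (hc : Stabilizes V c) : Stabilizes V (b - c) := fun x hx => by
  rw [sub_mul]
  exact V.sub_mem (hb x hx) (hc x hx)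

theorem Stabilizes.C_mul {V : Submodule ℂ (LaurentSeries ℂ)} {b : LaurentSeries ℂ}
    (hb : Stabilizes V b) (c : ℂ) : Stabilizes V (HahnSeries.C c * b) := fun x hx => by
  rw [mul_assoc, HahnSeries.C_mul_eq_smul]
  exact V.smul_mem _ (hb x hx)

theorem stabilizes_zero (V : Submodule ℂ (LaurentSeries ℂ)) : Stabilizes V 0 := fun x _ => by
  rw [zero_mul]
  exact V.zero_mem

section Space

variable {n : ℕ} {Γ : Matrix (Fin n) (Fin n) (LaurentSeries ℂ)} {S : PsiDO}

/-- A wave function with values in `W` all of whose modes are negative vanishes. -/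
theorem eq_zero_of_valuesIn (hn : 0 < n) (hΓ : IsUnipotentAtInfty Γ) {T : PsiDO}
    (hT : ∀ k, 0 ≤ k → T.coeff k = 0) (h : ValuesIn (polySpace Γ) T.wave) : T = 0 := by
  -- Once the symbol vanishes in lower degree in the times, the `α`-coefficient of the wave function
  -- is that of the symbol, since `exp(ξ)` has constant term `1`. It lies in the space and has only
  -- negative powers of `z`.
  have key : ∀ (N : ℕ) (α : ℕ+ →₀ ℕ), α.degree = N → MvPowerSeries.coeff α T.symbol = 0 := by
    intro N
    induction N using Nat.strong_induction_on with
    | _ N ih =>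
      intro α hα
      have h1 := h α
      rw [PsiDO.wave, MvPowerSeries.coeff_mul, Finset.sum_eq_single (0, α)] at h1
      · have h2 : MvPowerSeries.coeff 0 expXi = 1 := by
          rw [coeff_expXi]
          simp [weight]
        rw [h2, one_mul] at h1
        refine hΓ.eq_zero_of_mem_polySpace hn h1 fun l hl => ?_
        rw [PsiDO.coeff_symbol, hT _ (by omega), map_zero]
      · intro p hp hne
        have h2 := Finset.HasAntidiagonal.mem_antidiagonal.mp hp
        have h3 : p.1 ≠ 0 := fun h3 => hne (Prod.ext h3 (by rwa [h3, zero_add] at h2))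
        have h4 : p.1.degree ≠ 0 := fun h4 => h3 (Finsupp.degree_eq_zero_iff _ |>.mp h4)
        have h5 := congrArg Finsupp.degree h2
        rw [map_add] at h5
        rw [ih p.2.degree (by omega) p.2 rfl, mul_zero]
      · intro h2
        exact absurd (Finset.HasAntidiagonal.mem_antidiagonal.mpr (zero_add _)) h2
  apply PsiDO.symbol_injective
  rw [PsiDO.symbol_zero]
  ext1 α
  rw [key _ α rfl, map_zero]

/-- The `t₁`-derivatives of the wave function at `t = 0` span the elements of finite order. -/
theorem mem_span_wave (hn : 0 < n) (hΓ : IsUnipotentAtInfty Γ) (hS : S.IsMonicOfOrderZero)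
    (h : ValuesIn (polySpace Γ) S.wave) {x : LaurentSeries ℂ} (hx : x ∈ polySpace Γ) :
    x ∈ Submodule.span ℂ (Set.range fun k : ℕ =>
      MvPowerSeries.coeff (Finsupp.single 1 k) S.wave) := by
  -- Rescaling by `k!` makes the coefficient of `t₁ ^ k` monic of degree `k`.
  have h1 : ∀ k : ℕ, ((k.factorial : ℂ) •
      MvPowerSeries.coeff (Finsupp.single 1 k) S.wave).coeff (-(k : ℤ)) = 1 := fun k => by
    rw [HahnSeries.coeff_smul, PsiDO.coeff_wave, waveCoeff_single_self hS, smul_eq_mul,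
      mul_inv_cancel₀ (by exact_mod_cast k.factorial_ne_zero)]
  have h2 : ∀ k : ℕ, ∀ l < -(k : ℤ), ((k.factorial : ℂ) •
      MvPowerSeries.coeff (Finsupp.single 1 k) S.wave).coeff l = 0 := fun k l hl => by
    rw [HahnSeries.coeff_smul, ← neg_neg l, PsiDO.coeff_wave,
      waveCoeff_single_of_lt hS k (by omega), smul_zero]
  obtain ⟨y, hy, hxy⟩ := exists_mem_span_sub h1 h2 x
  have hyV : y ∈ polySpace Γ := by
    refine Submodule.span_le.mpr ?_ hy
    rintro _ ⟨k, rfl⟩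
    exact (polySpace Γ).smul_mem _ (h _)
  have := hΓ.eq_zero_of_mem_polySpace hn ((polySpace Γ).sub_mem hx hyV) hxy
  rw [sub_eq_zero.mp this]
  refine Submodule.span_le.mpr ?_ hy
  rintro _ ⟨k, rfl⟩
  exact Submodule.smul_mem _ _ (Submodule.subset_span ⟨k, rfl⟩)

theorem stabilizes_of_forall (hn : 0 < n) (hΓ : IsUnipotentAtInfty Γ)
    (hS : S.IsMonicOfOrderZero) (h : ValuesIn (polySpace Γ) S.wave) {b : LaurentSeries ℂ}
    (hb : ∀ k : ℕ, b * MvPowerSeries.coeff (Finsupp.single 1 k) S.wave ∈ polySpace Γ) :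
    Stabilizes (polySpace Γ) b := by
  intro x hx
  have hspan := mem_span_wave hn hΓ hS h hx
  clear hx
  induction hspan using Submodule.span_induction with
  | mem x hx =>
    obtain ⟨k, rfl⟩ := hx
    exact hb k
  | zero => rw [mul_zero]; exact Submodule.zero_mem _
  | add x y _ _ hx hy => rw [mul_add]; exact Submodule.add_mem _ hx hy
  | smul c x _ hx =>
    rw [← HahnSeries.C_mul_eq_smul, mul_left_comm, HahnSeries.C_mul_eq_smul]
    exact Submodule.smul_mem _ _ hx

/-- The wave function of `M * S` has values in the space because `M` is differential, and it equals
`b` times that of `S`. -/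
theorem stabilizes_of_conj (hn : 0 < n) (hΓ : IsUnipotentAtInfty Γ)
    (hS : S.IsMonicOfOrderZero) (h : ValuesIn (polySpace Γ) S.wave) {m : ℕ} {M : PsiDO}
    (hM : M.IsDiffOfOrder m) {b : LaurentSeries ℂ} (hb : M * S = S * PsiDO.ofLaurent b) :
    Stabilizes (polySpace Γ) b := by
  refine stabilizes_of_forall hn hΓ hS h fun k => ?_
  have h1 := h.mul_wave (M := M) (N := m + 1) (fun k hk => hM.2 k (by push_cast at hk; omega))
  rw [hb, PsiDO.wave_mul_ofLaurent] at h1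
  have h2 := h1 (Finsupp.single 1 k)
  rwa [MvPowerSeries.coeff_C_mul] at h2

/-- If `S P` has values in `W` and `P` does not involve `t₁`, then the coefficients of the symbol
of `P` stabilise `W`. -/
theorem stabilizes_coeff_symbol (hn : 0 < n) (hΓ : IsUnipotentAtInfty Γ)
    (hS : S.IsMonicOfOrderZero) (h : ValuesIn (polySpace Γ) S.wave) {P : PsiDO}
    (hP : ∀ k, dt (P.coeff k) = 0) (hSP : ValuesIn (polySpace Γ) (S * P).wave)
    (β : ℕ+ →₀ ℕ) : Stabilizes (polySpace Γ) (MvPowerSeries.coeff β P.symbol) := by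
  have hzero : ∀ β : ℕ+ →₀ ℕ, β 1 ≠ 0 → MvPowerSeries.coeff β P.symbol = 0 := by
    intro β hβ
    ext l
    rw [PsiDO.coeff_symbol, HahnSeries.coeff_zero]
    have h1 := congrArg (MvPowerSeries.coeff (β - Finsupp.single 1 1)) (hP (-l))
    have h2 : Finsupp.single 1 1 ≤ β := by
      rw [Finsupp.single_le_iff]
      omega
    rw [dt, MvPowerSeries.coeff_pderiv, tsub_add_cancel_of_le h2, map_zero] at h1
    exact (mul_eq_zero.mp h1).resolve_right (Nat.cast_add_one_ne_zero _)
  rw [PsiDO.wave_mul hP] at hSP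
  obtain ⟨N, hN⟩ : ∃ N, β.degree = N := ⟨_, rfl⟩
  induction N using Nat.strong_induction_on generalizing β with
  | _ N ih =>
    by_cases hβ : β 1 = 0
    swap
    · rw [hzero β hβ]
      exact stabilizes_zero _
    refine stabilizes_of_forall hn hΓ hS h fun k => ?_
    -- The symbol is free of `t₁`, so only its coefficients at `p.1 ≤ β` meet this monomial. Those
    -- with `p.1 ≠ β` have smaller degree and stabilise the space by induction; what remains is the
    -- `β`-coefficient times that of `t₁ ^ k`.
    have h1 := hSP (β + Finsupp.single 1 k)
    have hmem : (β, Finsupp.single 1 k) ∈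
        Finset.HasAntidiagonal.antidiagonal (β + Finsupp.single 1 k) :=
      Finset.HasAntidiagonal.mem_antidiagonal.mpr rfl
    rw [MvPowerSeries.coeff_mul, ← Finset.add_sum_erase _ _ hmem] at h1
    refine ((polySpace Γ).add_mem_iff_left (Submodule.sum_mem _ fun p hp => ?_)).mp h1
    obtain ⟨hne, hp⟩ := Finset.mem_erase.mp hp
    rw [Finset.HasAntidiagonal.mem_antidiagonal] at hp
    by_cases hp1 : p.1 1 = 0
    swap
    · rw [hzero _ hp1, zero_mul]
      exact Submodule.zero_mem _
    have hle : p.1 ≤ β := fun i => by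
      have h2 := DFunLike.congr_fun hp i
      by_cases hi : i = 1
      · rw [hi, hp1]; exact Nat.zero_le _
      · simp only [Finsupp.add_apply, Finsupp.single_apply, Ne.symm hi, if_false] at h2
        omega
    have h3 : (β - p.1).degree ≠ 0 := fun h3 => by
      have h4 := (Finsupp.degree_eq_zero_iff _).mp h3
      have h5 : p.1 = β := by rw [← tsub_add_cancel_of_le hle, h4, zero_add]
      rw [h5] at hp
      exact hne (Prod.ext h5 (add_left_cancel hp))
    have h4 := congrArg Finsupp.degree (tsub_add_cancel_of_le hle)
    rw [map_add] at h4
    exact ih p.1.degree (by omega) p.1 rfl _ (h _)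

/-- The matrix of a multiplier of `Γ ℂ[z]ⁿ` is polynomial. -/
theorem exists_polynomial_matrix (hn : 0 < n) {b : LaurentSeries ℂ}
    (hb : Stabilizes (polySpace Γ) b) : ∃ C : Matrix (Fin n) (Fin n) ℂ[X],
      Γ * C.map (polyPow 1) = evalLam b * Γ := by
  have h : ∀ j : Fin n, ∃ p : Fin n → ℂ[X],
      (evalLam b * Γ).col j = Γ.mulVec fun i => polyPow 1 (p i) := by
    intro j
    -- The series `x` corresponds to `Γ e_j`; the polynomial coordinates of `b x` form column `j` of
    -- `C`.
    obtain ⟨x, hx⟩ := split_surjective hn (Γ.col j)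
    have hxV : x ∈ polySpace Γ := by
      refine ⟨Pi.single j 1, ?_⟩
      have h1 : (fun i : Fin n => polyPow 1 ((Pi.single j 1 : Fin n → ℂ[X]) i)) =
          Pi.single j 1 := by
        ext1 i
        by_cases hij : i = j
        · subst hij; simp
        · simp [hij]
      rw [h1, Matrix.mulVec_single_one, hx]
    obtain ⟨p, hp⟩ := hb x hxV
    refine ⟨p, ?_⟩
    rw [← hp, split_mul, hx]
    rfl
  choose p hp using h
  refine ⟨Matrix.of fun i j => p j i, ?_⟩
  ext1 i j
  exact (congrFun (hp j) i).symm

theorem map_eq_conj (hn : 0 < n) (hΓ : IsUnipotentAtInfty Γ) {b : LaurentSeries ℂ}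
    {C : Matrix (Fin n) (Fin n) ℂ[X]} (hC : Γ * C.map (polyPow 1) = evalLam b * Γ) :
    C.map (polyPow 1) = Γ⁻¹ * evalLam b * Γ := by
  rw [Matrix.mul_assoc, ← hC, Matrix.nonsing_inv_mul_cancel_left _ _ (hΓ.isUnit_det hn)]

/-- The trace is invariant under conjugation, and all `n` diagonal entries of `b(Λ)` equal `∑ b_{nq}
z ^ q`. -/
theorem coeff_polyPow_trace (hn : 0 < n) (hΓ : IsUnipotentAtInfty Γ) {b : LaurentSeries ℂ}
    {C : Matrix (Fin n) (Fin n) ℂ[X]} (hC : Γ * C.map (polyPow 1) = evalLam b * Γ) (q : ℤ) :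
    (polyPow 1 C.trace).coeff q = n * b.coeff (n * q) := by
  have h1 : polyPow 1 C.trace = (C.map (polyPow 1)).trace := by
    simp [Matrix.trace, map_sum]
  have h2 : (Γ⁻¹ * evalLam b * Γ).trace = (evalLam b : Matrix (Fin n) (Fin n) _).trace := by
    rw [Matrix.mul_assoc, Matrix.trace_mul_comm, Matrix.mul_assoc,
      Matrix.mul_nonsing_inv _ (hΓ.isUnit_det hn), Matrix.mul_one]
  rw [h1, map_eq_conj hn hΓ hC, h2, Matrix.trace, HahnSeries.coeff_sum]
  simp only [Matrix.diag_apply, evalLam_coeff, sub_add_cancel]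
  simp

/-- The powers of `zⁿ` can be removed from a multiplier of `Γ ℂ[z]ⁿ`. -/
theorem Stabilizes.exists_traceless (hn : 0 < n) (hΓ : IsUnipotentAtInfty Γ)
    {b : LaurentSeries ℂ} (hb : Stabilizes (polySpace Γ) b) :
    ∃ b' : LaurentSeries ℂ, Stabilizes (polySpace Γ) b' ∧
      (∀ s : ℤ, b'.coeff (n * s) = 0) ∧
      ∀ l : ℤ, ¬ (n : ℤ) ∣ l → b'.coeff l = b.coeff l := by
  obtain ⟨C, hC⟩ := exists_polynomial_matrix hn hb
  have htr := coeff_polyPow_trace hn hΓ hC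
  have hn0 : (n : ℂ) ≠ 0 := by exact_mod_cast hn.ne'
  -- The part of `b` in powers of `zⁿ` is `C.trace / n` at `zⁿ`. As `C.trace` is a polynomial, this
  -- part is itself a multiplier.
  refine ⟨b - polyPow n (Polynomial.C (n : ℂ)⁻¹ * C.trace),
    hb.sub fun x hx => polyPow_mul_mem _ hx, fun s => ?_, fun l hl => ?_⟩
  · rw [HahnSeries.coeff_sub]
    rcases lt_or_ge 0 s with hs | hs
    · have h1 := htr s
      rw [coeff_polyPow_one_of_pos _ hs] at h1
      rw [(mul_eq_zero.mp h1.symm).resolve_left hn0, coeff_polyPow_eq_zero, sub_zero]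
      intro k hk
      have : (0 : ℤ) < n * s := by positivity
      have : (0 : ℤ) ≤ n * k := by positivity
      omega
    · obtain ⟨k, rfl⟩ : ∃ k : ℕ, s = -(k : ℤ) := ⟨(-s).toNat, by omega⟩
      have h1 := htr (-(k : ℤ))
      rw [coeff_polyPow_one] at h1
      rw [mul_neg] at h1 ⊢
      rw [coeff_polyPow n hn.ne', coeff_C_mul, h1, inv_mul_cancel_left₀ hn0, sub_self]
  · rw [HahnSeries.coeff_sub, coeff_polyPow_eq_zero, sub_zero]
    rintro k rfl
    exact hl (by simp)

end Space

/-! ## Existence of normalised Burchnall-Chaundy data -/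

theorem IsDressing.valuesIn {n : ℕ} (hn : 0 < n) {γ : MatLoop n} (hγ : IsHalfLoop γ)
    (hnorm : IsNormalized γ) (hcell : InBigCell (loopSpace γ)) {S : PsiDO}
    (hS : IsDressing (loopSpace γ) S) : ValuesIn (polySpace (loopSeries γ)) S.wave := fun α => by
  apply mem_polySpace_of_isFourierOfMem hn hγ hnorm hcell
  simp only [PsiDO.coeff_wave]
  exact hS.2 α

theorem exists_isBCData {n m : ℕ} (hn : 2 ≤ n) {γ : MatLoop n} (hγ : IsHalfLoop γ)
    (hnorm : IsNormalized γ) (hcell : InBigCell (loopSpace γ))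
    (hBC : InBCLocus (loopSpace γ) m) :
    ∃ (S L M : PsiDO) (b : LaurentSeries ℂ), IsBCData (loopSpace γ) m S L M b := by
  obtain ⟨hmn, S, L, M, ⟨hS, hLS⟩, hM, hLM⟩ := hBC
  have hn0 : 0 < n := by omega
  have hΓ := hnorm.isUnipotentAtInfty
  have hV := hS.valuesIn hn0 hγ hnorm hcell
  have hM' : ∀ k : ℤ, k < 0 ∨ ((m + 1 : ℕ) : ℤ) ≤ k → M.coeff k = 0 := fun k hk =>
    hM.2 k (by push_cast at hk; omega)
  obtain ⟨P, hP⟩ := hS.1.exists_left_quotient (M * S)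
  -- `P` stands for `S⁻¹ M S`, and it commutes with `Dⁿ = S⁻¹ L S`.
  have hP0 : ∀ k, dt (P.coeff k) = 0 := by
    refine PsiDO.dt_coeff_eq_zero_of_commute hn0.ne' ?_
    rw [← sub_eq_zero]
    apply hS.1.mul_right_eq_zero
    rw [PsiDO.ofLaurent_single] at hLS
    rw [mul_sub, ← mul_assoc, ← hLS, ← mul_assoc, hP, mul_assoc, hP, mul_assoc, ← hLS,
      ← mul_assoc, ← mul_assoc, hLM, sub_self]
  have hPV := stabilizes_coeff_symbol hn0 hΓ hS.1 hV hP0 (by rw [hP]; exact hV.mul_wave hM')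
  have hMb : ∀ i : ℤ, m < i → M.coeff i = 0 := fun i hi => hM.2 i (Or.inr hi)
  have hPb : ∀ i : ℤ, m < i → P.coeff i = 0 := by
    by_cases hP00 : P = 0
    · intro i _
      rw [hP00]
      rfl
    obtain ⟨a, ha, ha'⟩ := PsiDO.exists_top hP00
    have ham : a ≤ m := by
      by_contra h
      apply ha
      have h1 := PsiDO.coeff_mul_top hS.1.2 ha'
      rw [hP, hS.1.1, one_mul, PsiDO.coeff_mul_eq_zero hMb hS.1.2 (by omega)] at h1
      exact h1.symm
    exact fun i hi => ha' i (by omega)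
  have hPm : P.coeff m ≠ 0 := by
    have h1 := PsiDO.coeff_mul_top hS.1.2 hPb
    have h2 := PsiDO.coeff_mul_top hMb hS.1.2
    rw [hP, hS.1.1, one_mul, zero_add] at h1
    rw [hS.1.1, mul_one, add_zero] at h2
    rw [← h1, h2]
    exact hM.1
  -- `P` may still depend on `t₂, t₃, …`; a monomial occurring in its leading coefficient yields a
  -- multiplier of degree exactly `m`.
  obtain ⟨β, hβ⟩ : ∃ β, MvPowerSeries.coeff β (P.coeff m) ≠ 0 := by
    by_contra! h
    exact hPm (MvPowerSeries.ext fun β => by rw [h β, map_zero])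
  set c := MvPowerSeries.coeff β (P.coeff m) with hc
  obtain ⟨b, hbV, hbn, hb⟩ := ((hPV β).C_mul c⁻¹).exists_traceless hn0 hΓ
  have hcoeff : ∀ k : ℤ, (HahnSeries.C c⁻¹ * MvPowerSeries.coeff β P.symbol).coeff (-k) =
      c⁻¹ * MvPowerSeries.coeff β (P.coeff k) := fun k => by
    rw [HahnSeries.C_mul_eq_smul, HahnSeries.coeff_smul, PsiDO.coeff_symbol, neg_neg, smul_eq_mul]
  -- As `n ≥ 2` is coprime to `m`, removing the powers of `zⁿ` leaves the leading term intact.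
  have hnm : ¬ (n : ℤ) ∣ -(m : ℤ) := by
    rw [dvd_neg, Int.natCast_dvd_natCast]
    intro h
    have := Nat.Coprime.eq_one_of_dvd hmn.symm h
    omega
  have hlead : b.coeff (-(m : ℤ)) = 1 := by
    rw [hb _ hnm, hcoeff, inv_mul_cancel₀ hβ]
  have horder : ∀ k : ℤ, m < k → b.coeff (-k) = 0 := fun k hk => by
    by_cases h : (n : ℤ) ∣ -k
    · obtain ⟨s, hs⟩ := h
      rw [hs, hbn]
    · rw [hb _ h, hcoeff, hPb k hk, map_zero, mul_zero]
  have hbb : ∀ i : ℤ, m < i → (PsiDO.ofLaurent b).coeff i = 0 := fun i hi => by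
    rw [PsiDO.coeff_ofLaurent, horder i hi, map_zero]
  -- `M'` is the differential part of `S b(D) S⁻¹`. The remainder has negative order and a wave
  -- function with values in the space, so it vanishes.
  obtain ⟨M', hM1, hM2⟩ := hS.1.exists_right_quotient (m + 1) (S * PsiDO.ofLaurent b)
    fun k hk => PsiDO.coeff_mul_eq_zero hS.1.2 hbb (by push_cast at hk; omega)
  have hMS : M' * S = S * PsiDO.ofLaurent b := by
    rw [eq_comm, ← sub_eq_zero]
    refine eq_zero_of_valuesIn hn0 hΓ hM2 ?_
    rw [PsiDO.wave_sub, PsiDO.wave_mul_ofLaurent]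
    exact (hV.C_mul hbV).sub (hV.mul_wave hM1)
  refine ⟨S, L, M', b, ⟨hS, hLS⟩, ⟨?_, fun k hk => hM1 k (by push_cast; omega)⟩, ?_, hMS, hlead,
    horder, fun s => ?_⟩
  · have h1 := PsiDO.coeff_mul_top (a := m)
      (fun i hi => hM1 i (Or.inr (by push_cast; omega))) hS.1.2
    have h2 := PsiDO.coeff_mul_top hS.1.2 hbb
    rw [zero_add, hS.1.1, one_mul, PsiDO.coeff_ofLaurent, hlead, map_one] at h2
    rw [add_zero, hS.1.1, mul_one, hMS, h2] at h1
    rw [← h1]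
    exact one_ne_zero
  · rw [← sub_eq_zero]
    apply hS.1.mul_left_eq_zero
    have hcomm : ∀ x y : LaurentSeries ℂ, PsiDO.ofLaurent x * PsiDO.ofLaurent y =
        PsiDO.ofLaurent y * PsiDO.ofLaurent x := fun x y => by
      apply PsiDO.symbol_injective
      rw [PsiDO.symbol_mul_ofLaurent, PsiDO.symbol_mul_ofLaurent, PsiDO.symbol_ofLaurent,
        PsiDO.symbol_ofLaurent, mul_comm]
    rw [sub_mul, mul_assoc, mul_assoc, hMS, hLS, ← mul_assoc, ← mul_assoc, hLS, hMS, mul_assoc,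
      mul_assoc, hcomm, sub_self]
  · rw [← mul_neg, hbn]

section Matrix

variable {n m : ℕ} {Γ : Matrix (Fin n) (Fin n) (LaurentSeries ℂ)} {b : LaurentSeries ℂ}
  {C : Matrix (Fin n) (Fin n) ℂ[X]}

/-! ## Degrees of the entries -/

/-- Each column of `C` has degree exactly `m + j` with respect to the grading of `Ξ`. -/
theorem exists_hasDeg_col (hn : 0 < n) (hΓ : IsUnipotentAtInfty Γ) (hb : HasDeg b m)
    (hC : Γ * C.map (polyPow 1) = evalLam b * Γ) (j : Fin n) :
    ∃ y : LaurentSeries ℂ, HasDeg y (m + (j : ℕ)) ∧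
      ∀ (i : Fin n) (k : ℕ), (C i j).coeff k = y.coeff (-(n * k + (i : ℕ))) := by
  obtain ⟨y, hy⟩ := split_surjective hn fun i => polyPow 1 (C i j)
  -- Here `e` corresponds to `e_j`, `u` to `Γ e_j` and `y` to `C e_j`. Degrees: `e` and `u` have
  -- degree `j`, so `b u`, which corresponds to `Γ C e_j`, has degree `m + j`, and so does `y`.
  obtain ⟨e, he⟩ := split_surjective hn (Pi.single j (1 : LaurentSeries ℂ))
  obtain ⟨u, hu⟩ := split_surjective hn (Γ.mulVec (split n e))
  have hedeg : HasDeg e (j : ℕ) := by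
    constructor
    · have h1 := split_coeff e j 0
      rw [he, Pi.single_eq_same, mul_zero, zero_sub] at h1
      rw [← h1]
      simp
    · intro l hl
      obtain ⟨q, i, rfl⟩ := exists_eq_mul_sub hn l
      rw [← split_coeff, he]
      by_cases hij : i = j
      · subst hij
        rw [Pi.single_eq_same, HahnSeries.coeff_one, if_neg]
        rintro rfl
        simp at hl
      · rw [Pi.single_eq_of_ne hij]
        rfl
  have hbu : HasDeg (b * u) (m + (j : ℕ)) := hb.mul (hΓ.hasDeg hu hn hedeg)
  have hsplit : split n (b * u) = Γ.mulVec (split n y) := by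
    rw [split_mul, hu, he, hy, Matrix.mulVec_mulVec, ← hC, ← Matrix.mulVec_mulVec,
      Matrix.mulVec_single_one]
    rfl
  have hy0 : y ≠ 0 := by
    rintro rfl
    apply hbu.ne_zero
    apply split_injective hn
    rw [hsplit, split_zero, Matrix.mulVec_zero]
  obtain ⟨N, hN⟩ := exists_hasDeg hy0
  refine ⟨y, ?_, fun i k => ?_⟩
  · rwa [hbu.unique (hΓ.hasDeg hsplit hn hN)]
  · rw [← coeff_polyPow_one]
    have h1 := congrArg (fun f => (f i).coeff (-(k : ℤ))) hy
    simp only [split_coeff] at h1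
    rw [← h1]
    congr 1
    ring

theorem entry_degree_le (hn : 0 < n) (hΓ : IsUnipotentAtInfty Γ) (hb : HasDeg b m)
    (hC : Γ * C.map (polyPow 1) = evalLam b * Γ) {i j : Fin n} (hij : C i j ≠ 0) :
    ((i : ℕ) : ℤ) - ((j : ℕ) : ℤ) + n * (C i j).natDegree ≤ m := by
  obtain ⟨y, hy, hyc⟩ := exists_hasDeg_col hn hΓ hb hC j
  by_contra h
  apply hij
  rw [← leadingCoeff_eq_zero, leadingCoeff, hyc]
  exact hy.2 _ (by omega)

/-- The leading power `z ^ (m + j)` of column `j` sits in the component `i ≡ m + j` modulo `n`. -/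
theorem entry_degree_eq (hn : 0 < n) (hΓ : IsUnipotentAtInfty Γ) (hb : HasDeg b m)
    (hC : Γ * C.map (polyPow 1) = evalLam b * Γ) {i j : Fin n} (h : (m + j : ℕ) % n = i) :
    C i j ≠ 0 ∧ (m : ℤ) = ((i : ℕ) : ℤ) - ((j : ℕ) : ℤ) + n * (C i j).natDegree := by
  obtain ⟨y, hy, hyc⟩ := exists_hasDeg_col hn hΓ hb hC j
  have h1 : (n : ℤ) * ((m + j : ℕ) / n : ℕ) + (i : ℕ) = m + (j : ℕ) := by
    have := Nat.div_add_mod (m + j : ℕ) n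
    rw [h] at this
    exact_mod_cast this
  have h2 : (C i j).coeff ((m + j : ℕ) / n) ≠ 0 := by
    rw [hyc, h1]
    exact hy.1
  have h3 : C i j ≠ 0 := by
    intro h0
    rw [h0, coeff_zero] at h2
    exact h2 rfl
  refine ⟨h3, le_antisymm ?_ (entry_degree_le hn hΓ hb hC h3)⟩
  have h4 : (n : ℤ) * ((m + j : ℕ) / n : ℕ) ≤ n * (C i j).natDegree :=
    mul_le_mul_of_nonneg_left (by exact_mod_cast le_natDegree_of_ne_zero h2) (by positivity)
  omega

theorem isGreatest_col (hn : 0 < n) (hΓ : IsUnipotentAtInfty Γ) (hb : HasDeg b m)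
    (hC : Γ * C.map (polyPow 1) = evalLam b * Γ) (j : Fin n) :
    IsGreatest {d : ℤ | ∃ i, C i j ≠ 0 ∧
      d = ((i : ℕ) : ℤ) - ((j : ℕ) : ℤ) + n * (C i j).natDegree} m := by
  refine ⟨⟨⟨(m + j : ℕ) % n, Nat.mod_lt _ hn⟩, entry_degree_eq hn hΓ hb hC rfl⟩, ?_⟩
  rintro d ⟨i, hi, rfl⟩
  exact entry_degree_le hn hΓ hb hC hi

theorem isGreatest_row (hn : 0 < n) (hΓ : IsUnipotentAtInfty Γ) (hb : HasDeg b m)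
    (hC : Γ * C.map (polyPow 1) = evalLam b * Γ) (i : Fin n) :
    IsGreatest {d : ℤ | ∃ j, C i j ≠ 0 ∧
      d = ((i : ℕ) : ℤ) - ((j : ℕ) : ℤ) + n * (C i j).natDegree} m := by
  -- The column must satisfy `j ≡ i - m` modulo `n`; adding `(n - 1) * m` instead avoids a
  -- subtraction.
  refine ⟨⟨⟨(i + (n - 1) * m) % n, Nat.mod_lt _ hn⟩, entry_degree_eq hn hΓ hb hC ?_⟩, ?_⟩
  · simp only [Nat.add_mod_mod]
    obtain ⟨k, rfl⟩ : ∃ k, n = k + 1 := ⟨n - 1, by omega⟩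
    rw [Nat.add_sub_cancel, show m + (i + k * m) = (i : ℕ) + (k + 1) * m by ring,
      Nat.add_mul_mod_self_left, Nat.mod_eq_of_lt i.isLt]
  · rintro d ⟨j, hj, rfl⟩
    exact entry_degree_le hn hΓ hb hC hj

/-! ## The spectral curve -/

/-- `F(z, λ) ↦ F(zⁿ, b(z))`. -/
def curveHom (n : ℕ) (b : LaurentSeries ℂ) : ℂ[X][X] →+* LaurentSeries ℂ :=
  eval₂RingHom (polyPow n) b

/-- Cayley-Hamilton for `b(Λ)`, which is conjugate to `C`, pulled back along `b ↦ b(Λ)`; this map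
sends `p(zⁿ)` to the scalar matrix `p(z)`. -/
theorem curveHom_charpoly (hn : 0 < n) (hΓ : IsUnipotentAtInfty Γ)
    (hC : Γ * C.map (polyPow 1) = evalLam b * Γ) : curveHom n b C.charpoly = 0 := by
  obtain ⟨U, hU⟩ := (Matrix.isUnit_iff_isUnit_det Γ).mpr (hΓ.isUnit_det hn)
  have h1 : (C.charpoly.map (polyPow 1)) =
      (evalLam b : Matrix (Fin n) (Fin n) (LaurentSeries ℂ)).charpoly := by
    rw [← Matrix.charpoly_map, ← Matrix.charpoly_units_conj U, hU, hC, Matrix.mul_assoc,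
      Matrix.mul_nonsing_inv _ (hΓ.isUnit_det hn), Matrix.mul_one]
  have h2 := Matrix.aeval_self_charpoly (evalLam b : Matrix (Fin n) (Fin n) (LaurentSeries ℂ))
  rw [← h1, aeval_def, eval₂_map] at h2
  have h3 : evalLamHom n (curveHom n b C.charpoly) = 0 := by
    rw [curveHom, coe_eval₂RingHom, hom_eval₂, ← h2]
    congr 1
    exact RingHom.ext fun p => evalLam_polyPow p
  -- The map `b ↦ b(Λ)` is injective, since the first column determines `b`.
  apply split_injective hn
  ext1 i
  rw [split_zero, split, ← evalLamHom_apply, h3]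
  rfl

/-- The term in `λ ^ j` has degree congruent to `j m` modulo `n`. For `j < n` these classes are
distinct by coprimality, so nothing cancels. -/
theorem eq_zero_of_curveHom_eq_zero (hn : 0 < n) (hmn : Nat.Coprime m n) (hb : HasDeg b m)
    {R : ℂ[X][X]} (hR : R.natDegree < n) (h : curveHom n b R = 0) : R = 0 := by
  rw [curveHom, coe_eval₂RingHom, eval₂_eq_sum_range' _ hR] at h
  have hdeg : ∀ j, polyPow n (R.coeff j) * b ^ j ≠ 0 →
      HasDeg (polyPow n (R.coeff j) * b ^ j) (n * (R.coeff j).natDegree + j * m) := by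
    intro j hj
    refine (hasDeg_polyPow n hn.ne' fun h0 => hj ?_).mul (hb.pow j)
    rw [h0, map_zero, zero_mul]
  have hzero := eq_zero_of_sum_eq_zero (s := Finset.range n)
    (f := fun j => polyPow n (R.coeff j) * b ^ j)
    (N := fun j => n * (R.coeff j).natDegree + j * m) (fun j _ => hdeg j) (by
      intro i hi j hj _ _ hij
      have h1 : (n : ℤ) ∣ ((i : ℤ) - j) * m :=
        ⟨(R.coeff j).natDegree - (R.coeff i).natDegree, by linarith⟩
      have h2 : (n : ℤ) ∣ (i : ℤ) - j :=
        IsCoprime.dvd_of_dvd_mul_right (Nat.isCoprime_iff_coprime.mpr hmn.symm) h1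
      rw [Finset.mem_range] at hi hj
      have h3 := Int.eq_zero_of_abs_lt_dvd h2 (by rw [abs_lt]; omega)
      omega) h
  ext1 j
  rw [coeff_zero]
  by_cases hj : j < n
  · by_contra h0
    exact mul_ne_zero (hasDeg_polyPow n hn.ne' h0).ne_zero (hb.pow j).ne_zero
      (hzero j (Finset.mem_range.mpr hj))
  · exact coeff_eq_zero_of_natDegree_lt (by omega)

/-- Modulo the monic characteristic polynomial, a polynomial in the kernel leaves a remainder of
`λ`-degree below `n`, which must vanish. -/
theorem curveHom_eq_zero_iff (hn : 0 < n) (hΓ : IsUnipotentAtInfty Γ)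
    (hmn : Nat.Coprime m n) (hb : HasDeg b m) (hC : Γ * C.map (polyPow 1) = evalLam b * Γ)
    (F : ℂ[X][X]) : curveHom n b F = 0 ↔ C.charpoly ∣ F := by
  have hχ := curveHom_charpoly hn hΓ hC
  constructor
  · intro h
    have hmonic := C.charpoly_monic
    rw [← modByMonic_eq_zero_iff_dvd hmonic]
    have hdeg : C.charpoly.natDegree = n := by
      rw [Matrix.charpoly_natDegree_eq_dim, Fintype.card_fin]
    refine eq_zero_of_curveHom_eq_zero hn hmn hb ?_ ?_
    · have h1 : C.charpoly ≠ 1 := fun h1 => by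
        rw [h1, natDegree_one] at hdeg
        omega
      have := natDegree_modByMonic_lt F hmonic h1
      rwa [hdeg] at this
    · rw [modByMonic_eq_sub_mul_div, map_sub, map_mul, hχ, h, zero_mul, sub_zero]
  · rintro ⟨G, rfl⟩
    rw [map_mul, hχ, zero_mul]

/-- It generates the kernel of a homomorphism to a field, so it is a prime element. -/
theorem irreducible_charpoly (hn : 0 < n) (hΓ : IsUnipotentAtInfty Γ)
    (hmn : Nat.Coprime m n) (hb : HasDeg b m) (hC : Γ * C.map (polyPow 1) = evalLam b * Γ) :
    Irreducible C.charpoly := by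
  have hiff := curveHom_eq_zero_iff hn hΓ hmn hb hC
  refine Prime.irreducible ⟨C.charpoly_monic.ne_zero, fun h => ?_, fun F G h => ?_⟩
  · exact (h.map (curveHom n b)).ne_zero (curveHom_charpoly hn hΓ hC)
  · rw [← hiff, ← hiff]
    rw [← hiff, map_mul] at h
    exact mul_eq_zero.mp h

end Matrix

/-! ## Polynomial relations between `L` and `M` -/

namespace PsiDO

theorem IsMonicOfOrderZero.eq_zero_of_C_mul_symbol {S : PsiDO} (hS : S.IsMonicOfOrderZero)
    {x : LaurentSeries ℂ} (h : MvPowerSeries.C x * S.symbol = 0) : x = 0 := by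
  have h1 := congrArg (MvPowerSeries.coeff 0) h
  rw [MvPowerSeries.coeff_C_mul, map_zero] at h1
  refine (mul_eq_zero.mp h1).resolve_right fun h2 => ?_
  have h3 := coeff_symbol S 0 0
  rw [h2, neg_zero, hS.1] at h3
  simp at h3

theorem symbol_pow_mul {S L : PsiDO} {x : LaurentSeries ℂ} (h : L * S = S * ofLaurent x)
    {T : PsiDO} {y : LaurentSeries ℂ} (hT : T.symbol = MvPowerSeries.C y * S.symbol) (i : ℕ) :
    (L ^ i * T).symbol = MvPowerSeries.C (x ^ i * y) * S.symbol := by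
  have hTS : T = S * ofLaurent y := by
    apply symbol_injective
    rw [hT, symbol_mul_ofLaurent, mul_comm]
  have hL : ∀ i : ℕ, (L ^ i * S).symbol = MvPowerSeries.C (x ^ i) * S.symbol := by
    intro i
    induction i with
    | zero => simp
    | succ i ih =>
      rw [pow_succ, mul_assoc, h, ← mul_assoc, symbol_mul_ofLaurent, ih, pow_succ, map_mul]
      ring
  rw [hTS, ← mul_assoc, symbol_mul_ofLaurent, hL, map_mul]
  ring

end PsiDO

/-- On symbols, `F(L, M) S = S F(Dⁿ, b(D))` reads as multiplication of the symbol of `S` by `F(zⁿ,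
b(z))`, and monic `S` can be cancelled on both sides. -/
theorem annihilates_iff {n : ℕ} {S L M : PsiDO} {b : LaurentSeries ℂ}
    (hS : S.IsMonicOfOrderZero) (hL : L * S = S * PsiDO.ofLaurent (HahnSeries.single (-(n : ℤ)) 1))
    (hM : M * S = S * PsiDO.ofLaurent b) (F : ℂ[X][X]) :
    Annihilates F L M ↔ curveHom n b F = 0 := by
  set X : PsiDO := ∑ j ∈ F.support, ∑ i ∈ (F.coeff j).support,
    (MvPowerSeries.C ((F.coeff j).coeff i) : TimeRing) • (L ^ i * M ^ j) with hX
  have h1 : Annihilates F L M ↔ X = 0 := by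
    rw [PsiDO.ext_iff, funext_iff]
    refine forall_congr' fun k => ?_
    rw [hX, PsiDO.coeff_sum]
    simp only [PsiDO.coeff_sum, PsiDO.coeff_smul, MvPowerSeries.smul_eq_C_mul,
      PsiDO.npow_eq_pow]
    rfl
  have hsum : ∀ {ι : Type} (s : Finset ι) (f : ι → PsiDO),
      (∑ i ∈ s, f i).symbol = ∑ i ∈ s, (f i).symbol := fun s f =>
    map_sum (⟨⟨PsiDO.symbol, PsiDO.symbol_zero⟩, PsiDO.symbol_add⟩ : PsiDO →+ WaveRing) f s
  have h2 : (X * S).symbol = MvPowerSeries.C (curveHom n b F) * S.symbol := by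
    rw [hX, Finset.sum_mul, hsum, curveHom, coe_eval₂RingHom, eval₂_eq_sum, Polynomial.sum,
      map_sum, Finset.sum_mul]
    refine Finset.sum_congr rfl fun j _ => ?_
    have h3 : polyPow n (F.coeff j) = ∑ i ∈ (F.coeff j).support,
        HahnSeries.C ((F.coeff j).coeff i) * HahnSeries.single (-(n : ℤ)) 1 ^ i := by
      rw [polyPow, coe_eval₂RingHom, eval₂_eq_sum, Polynomial.sum]
    rw [Finset.sum_mul, hsum, h3, Finset.sum_mul, map_sum, Finset.sum_mul]
    refine Finset.sum_congr rfl fun i _ => ?_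
    have h4 : (M ^ j * S).symbol = MvPowerSeries.C (b ^ j) * S.symbol := by
      have := PsiDO.symbol_pow_mul hM (T := S) (y := 1) (by simp) j
      rwa [mul_one] at this
    rw [PsiDO.smul_mul, mul_assoc, PsiDO.symbol_smul, PsiDO.symbol_pow_mul hL h4, mul_assoc,
      map_mul MvPowerSeries.C (HahnSeries.C _), mul_assoc]
    congr 1
    rw [timeToWave, MvPowerSeries.map_C]
  rw [h1]
  constructor
  · intro h
    rw [h, zero_mul, PsiDO.symbol_zero] at h2
    exact hS.eq_zero_of_C_mul_symbol h2.symm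
  · intro h
    rw [h, map_zero, zero_mul, ← PsiDO.symbol_zero] at h2
    exact hS.mul_left_eq_zero (PsiDO.symbol_injective h2)

theorem polySeries_eq {n : ℕ} (C : Matrix (Fin n) (Fin n) ℂ[X]) :
    polySeries C = C.map (polyPow 1) := by
  ext1 i j
  exact aeval_zVar _

end GelfandDickey

end

/-! ### The main theorem -/

theorem mainTheorem11 (n m : ℕ) (hn : 2 ≤ n)
    (γ : GelfandDickey.MatLoop n) (hγ : GelfandDickey.IsHalfLoop γ)
    (hnorm : GelfandDickey.IsNormalized γ)
    (hcell : GelfandDickey.InBigCell (GelfandDickey.loopSpace γ))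
    (hBC : GelfandDickey.InBCLocus (GelfandDickey.loopSpace γ) m) :
    (∃ (S L M : GelfandDickey.PsiDO) (b : LaurentSeries ℂ),
      GelfandDickey.IsBCData (GelfandDickey.loopSpace γ) m S L M b) ∧
    ∀ (S L M : GelfandDickey.PsiDO) (b : LaurentSeries ℂ),
      GelfandDickey.IsBCData (GelfandDickey.loopSpace γ) m S L M b →
      ∃ C : Matrix (Fin n) (Fin n) (Polynomial ℂ),
        GelfandDickey.polySeries C =
          (GelfandDickey.loopSeries γ)⁻¹ * GelfandDickey.evalLam b * GelfandDickey.loopSeries γ ∧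
        C.trace = 0 ∧
        (∀ j, IsGreatest {d : ℤ | ∃ i, C i j ≠ 0 ∧
          d = ((i : ℕ) : ℤ) - ((j : ℕ) : ℤ) + n * (C i j).natDegree} m) ∧
        (∀ i, IsGreatest {d : ℤ | ∃ j, C i j ≠ 0 ∧
          d = ((i : ℕ) : ℤ) - ((j : ℕ) : ℤ) + n * (C i j).natDegree} m) ∧
        Irreducible C.charpoly ∧
        ∀ F : Polynomial (Polynomial ℂ),
          GelfandDickey.Annihilates F L M ↔ C.charpoly ∣ F := by
  refine ⟨GelfandDickey.exists_isBCData hn hγ hnorm hcell hBC, fun S L M b h => ?_⟩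
  have hn0 : 0 < n := by omega
  have hΓ := hnorm.isUnipotentAtInfty
  have hS := h.lax.1
  have hmn := hBC.1
  have hb : GelfandDickey.HasDeg b m := by
    refine ⟨by rw [h.lead]; exact one_ne_zero, fun l hl => ?_⟩
    rw [← neg_neg l]
    exact h.order _ (by omega)
  obtain ⟨C, hC⟩ := GelfandDickey.exists_polynomial_matrix hn0
    (GelfandDickey.stabilizes_of_conj hn0 hΓ hS.1 (hS.valuesIn hn0 hγ hnorm hcell) h.diff h.conj)
  refine ⟨C, ?_, ?_, GelfandDickey.isGreatest_col hn0 hΓ hb hC,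
    GelfandDickey.isGreatest_row hn0 hΓ hb hC,
    GelfandDickey.irreducible_charpoly hn0 hΓ hmn hb hC, fun F => ?_⟩
  · rw [GelfandDickey.polySeries_eq, GelfandDickey.map_eq_conj hn0 hΓ hC]
  · apply GelfandDickey.polyPow_one_injective
    ext q
    rw [GelfandDickey.coeff_polyPow_trace hn0 hΓ hC, map_zero, ← neg_neg ((n : ℤ) * q), ← mul_neg,
      h.traceless, mul_zero]
    rfl
  · rw [GelfandDickey.annihilates_iff hS.1 h.lax.2 h.conj,
      GelfandDickey.curveHom_eq_zero_iff hn0 hΓ hmn hb hC]
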